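/- Let $n\ge 2$ and let $S^n$ be a simplicial piecewise flat manifold without boundary: a locally finite complex in which every simplex is a face of an $n$-simplex, the $n$-simplices are non-degenerate Euclidean simplices with metrics agreeing on common faces, and the $n$-simplices containing a given $(n-2)$-simplex (hinge) $h$ form a single closed cycle around $h$. The deficit angle of $h$ is $\epsilon_h=2\pi-\sum_{\sigma\supset h}\theta_\sigma(h)$, with $\theta_\sigma(h)$ the dihedral angle of the $n$-simplex $\sigma$ at $h$. Let $T_h$ be the parallel transport of vectors once around $h$ (developing each simplex next to the following one), acting on $\mathbb R^n$, and let $\omega_h$ be the area form of the planes orthogonal to $h$ (extended to $\mathbb R^n$ by orthogonal projection), oriented by the sense of the loop. The integral over a region $U$ of the sectional curvature of the planes parallel to orthonormal $u,w$ is computed leafwise by parallel transport, a leaf through a point of $h$ contributing $\langle T_h u,w\rangle$ and $h\cap U$ having transverse measure $\omega_h(u,w)\,|h\cap U|$; summing over the pairs of an orthonormal basis $(e_i)$, the integral and average of the scalar curvature over $U$ are $$\int_U R\,dV=\sum_h\int_{h\cap U}\sum_{i,j}\omega_h(e_i,e_j)\,\langle T_h e_i,e_j\rangle\,dV^{n-2},\qquad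 \widetilde R_U=\frac1{|U|}\int_U R\,dV,$$ where $|\cdot|$ denotes $n$-volume for regions and $(n-2)$-volume for (parts of) hinges. (a) Let $(V_v)$ be open regions indexed by the vertices such that $V_v$ contains $v$ and no other vertex, the $V_v$ are pairwise disjoint with $|S^n|=\sum_v|V_v|$, and every hinge that intersects $V_v$ lies in the star of $v$ (has $v$ as a vertex). Then for every vertex $v$, with sums over the hinges $h$ in the star of $v$, $$\widetilde R_{V_v}=\frac{2}{|V_v|}\sum_{h}|h\cap V_v|\sin\epsilon_h,\qquad \Big|\widetilde R_{V_v}-\frac{2}{|V_v|}\sum_{h}|h\cap V_v|\,\epsilon_h\Big|\le\frac{1}{3|V_v|}\sum_{h}|h\cap V_v|\,|\epsilon_h|^3,$$ so that $R_v=\frac{2}{|V_v|}\sum_{h\subset\mathrm{star}(v)}|h\cap V_v|\,\epsilon_h$ to leading order in the deficit angles. (b) Let $n=3$, and let either $V_v$ be the barycentric dual volumes (the points whose barycentric coordinate at $v$ is strictly larger than all others), or let every simplex of $S^3$ contain its circumcenter (possibly on its boundary) and $V_v$ be the circumcentric (Voronoi) dual volumes (the points which, in every closed tetrahedron containing them,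 are strictly closer to the vertex $v$ than to the other vertices). Then for every vertex $v$, with sums over the edges $h$ at $v$, $$\widetilde R_{V_v}=\frac{1}{|V_v|}\sum_{h}|h|\sin\epsilon_h,\qquad \Big|\widetilde R_{V_v}-\frac{1}{|V_v|}\sum_{h}|h|\,\epsilon_h\Big|\le\frac{1}{6|V_v|}\sum_{h}|h|\,|\epsilon_h|^3.$$ -/

import Mathlib

open MeasureTheory
open scoped ENNReal RealInnerProductSpace

noncomputable section

/-- `LinkCycle facets h` says that the top-dimensional simplices containing the codimension-2
simplex `h` form one closed cycle around `h`: they are the simplices `h ∪ {vert i, vert (i+1)}`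
for `i < len`, each occurring once, the indices being taken modulo `len`. -/
structure LinkCycle {V : Type*} [DecidableEq V] (facets : Set (Finset V)) (h : Finset V) where
  len : ℕ
  vert : ℕ → V
  three_le : 3 ≤ len
  periodic : ∀ i, vert (i + len) = vert i
  injOn : Set.InjOn vert (Set.Iio len)
  star : ∀ σ : Finset V, (σ ∈ facets ∧ h ⊆ σ) ↔
    ∃ i < len, σ = insert (vert i) (insert (vert (i + 1)) h)

/-- An `n`-dimensional simplicial piecewise flat manifold (without boundary) with vertex set `V`:
a locally finite homogeneous simplicial `n`-complex, given by its `n`-simplices `facets`, each of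
which is realised as a non-degenerate Euclidean simplex with vertices `pos σ v`, such that the
metrics induced on common faces agree.  The condition `link` is the part of the manifold condition
that concerns codimension-2 simplices: their stars are (cone) × (simplex). -/
structure PiecewiseFlat (n : ℕ) (V : Type*) [DecidableEq V] where
  facets : Set (Finset V)
  card_facet : ∀ σ ∈ facets, σ.card = n + 1
  exists_facet : ∀ v : V, ∃ σ ∈ facets, v ∈ σ
  locallyFinite : ∀ v : V, {σ | σ ∈ facets ∧ v ∈ σ}.Finite
  pos : Finset V → V → EuclideanSpace ℝ (Fin n)
  affineIndependent : ∀ σ ∈ facets, AffineIndependent ℝ (fun v : σ => pos σ v)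
  compat : ∀ σ ∈ facets, ∀ τ ∈ facets, ∀ u ∈ σ ∩ τ, ∀ w ∈ σ ∩ τ,
    dist (pos σ u) (pos σ w) = dist (pos τ u) (pos τ w)
  link : ∀ h : Finset V, h.card + 1 = n → (∃ σ ∈ facets, h ⊆ σ) → Nonempty (LinkCycle facets h)

namespace PiecewiseFlat

/-! ### The underlying space and its simplices -/

/-- The points of the underlying space, in barycentric coordinates (with the topology of
coordinatewise convergence, which for a locally finite complex is the usual one). -/
abbrev Point {n : ℕ} {V : Type*} [DecidableEq V] (S : PiecewiseFlat n V) : Type _ :=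
  {x : V → ℝ // (∀ v, 0 ≤ x v) ∧
    ∃ σ ∈ S.facets, (∀ v, v ∉ σ → x v = 0) ∧ ∑ v ∈ σ, x v = 1}

/-- The vertex `v` as a point of the space. -/
def vertex {n : ℕ} {V : Type*} [DecidableEq V] (S : PiecewiseFlat n V) (v : V) : S.Point :=
  ⟨Pi.single v 1, by
    refine ⟨fun w => ?_, ?_⟩
    · by_cases h : w = v
      · subst h; simp
      · simp [h]
    · obtain ⟨σ, hσ, hv⟩ := S.exists_facet v
      refine ⟨σ, hσ, fun w hw => ?_, ?_⟩
      · have : w ≠ v := fun h => hw (h ▸ hv)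
        simp [this]
      · simp [Pi.single_apply, hv]⟩

/-- The closed simplex spanned by the vertices in `τ`. -/
def closedSimplex {n : ℕ} {V : Type*} [DecidableEq V] (S : PiecewiseFlat n V) (τ : Finset V) :
    Set S.Point :=
  {p | ∀ w, w ∉ τ → p.1 w = 0}

/-- The open simplex spanned by the vertices in `τ`. -/
def openSimplex {n : ℕ} {V : Type*} [DecidableEq V] (S : PiecewiseFlat n V) (τ : Finset V) :
    Set S.Point :=
  {p | (∀ w ∈ τ, 0 < p.1 w) ∧ ∀ w, w ∉ τ → p.1 w = 0}

/-- The position in the Euclidean `n`-simplex `σ` of a point of the closed simplex `σ`. -/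
def place {n : ℕ} {V : Type*} [DecidableEq V] (S : PiecewiseFlat n V) (σ : Finset V)
    (p : S.Point) : EuclideanSpace ℝ (Fin n) :=
  ∑ v ∈ σ, p.1 v • S.pos σ v

/-- The `n`-volume of a region of the piecewise flat manifold. -/
def vol {n : ℕ} {V : Type*} [DecidableEq V] (S : PiecewiseFlat n V) (U : Set S.Point) : ℝ≥0∞ :=
  ∑' σ : S.facets, volume (S.place σ.1 '' (U ∩ S.openSimplex σ.1))

/-! ### Hinges -/

/-- The hinges: the `(n-2)`-simplices, given by their `n - 1` vertices. -/
abbrev Hinge {n : ℕ} {V : Type*} [DecidableEq V] (S : PiecewiseFlat n V) : Type _ :=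
  {h : Finset V // h.card + 1 = n ∧ ∃ σ ∈ S.facets, h ⊆ σ}

theorem finite_hingesAt {n : ℕ} {V : Type*} [DecidableEq V] (S : PiecewiseFlat n V) (v : V) :
    {h : S.Hinge | v ∈ h.1}.Finite := by
  refine Set.Finite.of_finite_image (f := Subtype.val) ?_ Subtype.val_injective.injOn
  refine ((S.locallyFinite v).biUnion
    (t := fun σ => (σ.powerset : Set (Finset V))) fun σ _ => Finset.finite_toSet _).subset ?_
  rintro _ ⟨h, hv, rfl⟩
  obtain ⟨σ, hσ, hs⟩ := h.2.2
  exact Set.mem_biUnion (x := σ) ⟨hσ, hs hv⟩ (by simpa using hs)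

/-- The (finitely many) hinges in the star of the vertex `v`. -/
def hingesAt {n : ℕ} {V : Type*} [DecidableEq V] (S : PiecewiseFlat n V) (v : V) :
    Finset S.Hinge :=
  (S.finite_hingesAt v).toFinset

/-- A cyclic enumeration of the star of a hinge. -/
def cycle {n : ℕ} {V : Type*} [DecidableEq V] (S : PiecewiseFlat n V) (h : S.Hinge) :
    LinkCycle S.facets h.1 :=
  Classical.choice (S.link h.1 h.2.1 h.2.2)

/-- The `i`-th `n`-simplex around the hinge `h`. -/
def around {n : ℕ} {V : Type*} [DecidableEq V] (S : PiecewiseFlat n V) (h : S.Hinge) (i : ℕ) :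
    Finset V :=
  insert ((S.cycle h).vert i) (insert ((S.cycle h).vert (i + 1)) h.1)

/-- In the Euclidean simplex `σ ⊇ h ∪ {a}`: the component orthogonal to `h` of a vector from `h` to
the vertex `a`, i.e. a vector that is orthogonal to `h` and points along the face `h ∪ {a}`. -/
def normalVec {n : ℕ} {V : Type*} [DecidableEq V] (S : PiecewiseFlat n V) (σ h : Finset V)
    (a : V) : EuclideanSpace ℝ (Fin n) :=
  ((vectorSpan ℝ (S.pos σ '' h))ᗮ).starProjection (S.pos σ a -ᵥ h.centroid ℝ (S.pos σ))

/-- The dihedral angle at `h` of the `n`-simplex `σ = h ∪ {a, b}`: the angle between the faces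
`h ∪ {a}` and `h ∪ {b}`, in a plane orthogonal to `h`. -/
def dihedralAngle {n : ℕ} {V : Type*} [DecidableEq V] (S : PiecewiseFlat n V) (σ h : Finset V)
    (a b : V) : ℝ :=
  InnerProductGeometry.angle (S.normalVec σ h a) (S.normalVec σ h b)

/-- The deficit angle of a hinge. -/
def deficitAngle {n : ℕ} {V : Type*} [DecidableEq V] (S : PiecewiseFlat n V) (h : S.Hinge) : ℝ :=
  2 * Real.pi - ∑ i ∈ Finset.range (S.cycle h).len,
    S.dihedralAngle (S.around h i) h.1 ((S.cycle h).vert i) ((S.cycle h).vert (i + 1))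

/-- The part of the hinge `h` that lies in `U`, seen in a Euclidean `n`-simplex containing `h`. -/
def hingePart {n : ℕ} {V : Type*} [DecidableEq V] (S : PiecewiseFlat n V) (h : S.Hinge)
    (U : Set S.Point) : Set (EuclideanSpace ℝ (Fin n)) :=
  S.place (S.around h 0) '' (U ∩ S.openSimplex h.1)

/-- The `(n-2)`-volume `|h ∩ U|`. -/
def hingeVol {n : ℕ} {V : Type*} [DecidableEq V] (S : PiecewiseFlat n V) (h : S.Hinge)
    (U : Set S.Point) : ℝ :=
  (μHE[n - 2] : Measure (EuclideanSpace ℝ (Fin n))).real (S.hingePart h U)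

/-! ### Parallel transport and curvature -/

/-- `g` develops the Euclidean simplex `σ` next to the Euclidean simplex `τ`: it matches the
common face, and puts the two simplices on opposite sides of it. -/
def IsDevelopment {n : ℕ} {V : Type*} [DecidableEq V] (S : PiecewiseFlat n V) (σ τ : Finset V)
    (g : EuclideanSpace ℝ (Fin n) ≃ᵃⁱ[ℝ] EuclideanSpace ℝ (Fin n)) : Prop :=
  (∀ v ∈ σ ∩ τ, g (S.pos σ v) = S.pos τ v) ∧
  ∀ a ∈ σ \ τ, ∀ b ∈ τ \ σ,
    (affineSpan ℝ (S.pos τ '' (σ ∩ τ : Finset V))).SOppSide (g (S.pos σ a)) (S.pos τ b)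

open Classical in
/-- Parallel transport of vectors from the `n`-simplex `σ` to a neighbouring `n`-simplex `τ`,
across their common `(n-1)`-face: the linear part of the (unique) development. -/
def transport {n : ℕ} {V : Type*} [DecidableEq V] (S : PiecewiseFlat n V) (σ τ : Finset V) :
    EuclideanSpace ℝ (Fin n) ≃ₗᵢ[ℝ] EuclideanSpace ℝ (Fin n) :=
  if hg : ∃ g, S.IsDevelopment σ τ g then hg.choose.linearIsometryEquiv
  else LinearIsometryEquiv.refl ℝ _

/-- Parallel transport along a path that runs through the `n`-simplices
`s 0, s 1, …, s k` in this order, each adjacent to the next. -/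
def transportAlong {n : ℕ} {V : Type*} [DecidableEq V] (S : PiecewiseFlat n V)
    (s : ℕ → Finset V) : ℕ → (EuclideanSpace ℝ (Fin n) ≃ₗᵢ[ℝ] EuclideanSpace ℝ (Fin n))
  | 0 => LinearIsometryEquiv.refl ℝ _
  | k + 1 => (transportAlong S s k).trans (S.transport (s k) (s (k + 1)))

/-- Parallel transport once around the hinge `h`, starting and ending in the simplex
`around h 0`. -/
def holonomy {n : ℕ} {V : Type*} [DecidableEq V] (S : PiecewiseFlat n V) (h : S.Hinge) :
    EuclideanSpace ℝ (Fin n) ≃ₗᵢ[ℝ] EuclideanSpace ℝ (Fin n) :=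
  S.transportAlong (S.around h) (S.cycle h).len

/-- The area form of the planes orthogonal to `h`, oriented by the sense of the loop around `h`:
the signed area of the orthogonal projection of the parallelogram `(u, v)` to such a plane. -/
def normalArea {n : ℕ} {V : Type*} [DecidableEq V] (S : PiecewiseFlat n V) (h : S.Hinge)
    (u v : EuclideanSpace ℝ (Fin n)) : ℝ :=
  let A := S.normalVec (S.around h 0) h.1 ((S.cycle h).vert 0)
  let B := S.normalVec (S.around h 0) h.1 ((S.cycle h).vert 1)
  (⟪A, u⟫ * ⟪B, v⟫ - ⟪A, v⟫ * ⟪B, u⟫) / Real.sqrt (‖A‖ ^ 2 * ‖B‖ ^ 2 - ⟪A, B⟫ ^ 2)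

/-- The integral of the sectional curvature `K(u, v)`, for orthonormal `u, v`, over a region
around `h`, per unit of `(n-2)`-volume of `h`.  The region is foliated by surfaces parallel to
`u, v`.  A surface through a point of `h` contributes `⟪T u, v⟫`, with `T` the parallel transport
around its boundary; a surface that does not enclose a point of a hinge has trivial transport and
contributes nothing.  The surfaces that meet a part of `h` have transverse volume
`normalArea h u v` times the volume of that part; thus planes orthogonal to `h` have factor `1`
and planes containing a direction of `h` have factor `0`. -/
def sectionalDensity {n : ℕ} {V : Type*} [DecidableEq V] (S : PiecewiseFlat n V) (h : S.Hinge)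
    (u v : EuclideanSpace ℝ (Fin n)) : ℝ :=
  S.normalArea h u v * ⟪S.holonomy h u, v⟫

/-- The same for the scalar curvature `R = ∑ i, ∑ j, K(e i, e j) = 2 ∑ i < j, K(e i, e j)`,
with `e` an orthonormal basis. -/
def scalarDensity {n : ℕ} {V : Type*} [DecidableEq V] (S : PiecewiseFlat n V) (h : S.Hinge) : ℝ :=
  ∑ i : Fin n, ∑ j : Fin n,
    S.sectionalDensity h (EuclideanSpace.basisFun (Fin n) ℝ i)
      (EuclideanSpace.basisFun (Fin n) ℝ j)

/-- The integral of the scalar curvature over a region `U`: the sum, over all hinges `h`, of the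
integrals over the parts `h ∩ U` (the manifold is flat away from the hinges). -/
def integralScalar {n : ℕ} {V : Type*} [DecidableEq V] (S : PiecewiseFlat n V)
    (U : Set S.Point) : ℝ :=
  ∑' h : S.Hinge, ∫ _p in S.hingePart h U, S.scalarDensity h ∂μHE[n - 2]

/-- The average scalar curvature over a region. -/
def averageScalar {n : ℕ} {V : Type*} [DecidableEq V] (S : PiecewiseFlat n V)
    (U : Set S.Point) : ℝ :=
  S.integralScalar U / (S.vol U).toReal

/-! ### Dual tessellations -/

/-- The family of open regions `D v` is a tessellation dual to the vertices. -/
structure IsDualTessellation {n : ℕ} {V : Type*} [DecidableEq V] (S : PiecewiseFlat n V)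
    (D : V → Set S.Point) : Prop where
  isOpen : ∀ v, IsOpen (D v)
  vertex_mem : ∀ v w, S.vertex w ∈ D v ↔ w = v
  vol_eq : S.vol Set.univ = ∑' v, S.vol (D v)
  disjoint : ∀ v w, v ≠ w → D v ∩ D w = ∅
  hinge_mem : ∀ v, ∀ h : S.Hinge, (S.openSimplex h.1 ∩ D v).Nonempty → v ∈ h.1

/-- The barycentric dual volume of `v`: the open star of `v` in the barycentric subdivision, i.e.
in each simplex containing `v` the polytope with corners at the barycenters of its faces
containing `v`.  These are the points whose barycentric coordinate at `v` is the largest. -/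
def barycentricDual {n : ℕ} {V : Type*} [DecidableEq V] (S : PiecewiseFlat n V) (v : V) :
    Set S.Point :=
  {p | ∀ w, w ≠ v → p.1 w < p.1 v}

/-- Every simplex contains its circumcenter (possibly on its boundary). -/
def ContainsCircumcenters {n : ℕ} {V : Type*} [DecidableEq V] (S : PiecewiseFlat n V) : Prop :=
  ∀ σ ∈ S.facets, ∀ τ ⊆ σ, τ.Nonempty →
    ∃ c ∈ convexHull ℝ (S.pos σ '' τ), ∃ r : ℝ, ∀ v ∈ τ, dist c (S.pos σ v) = r

/-- The circumcentric (Voronoi) dual volume of `v`: the points that, in each closed `n`-simplex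
containing them, are closer to `v` than to any other vertex.  It is used for manifolds whose
simplices contain their circumcenters; then it is the region with corners at the circumcenters of
the simplices in the star of `v`, and no other vertex of the manifold is as close as `v`. -/
def voronoiDual {n : ℕ} {V : Type*} [DecidableEq V] (S : PiecewiseFlat n V) (v : V) :
    Set S.Point :=
  {p | ∀ σ ∈ S.facets, p ∈ S.closedSimplex σ → v ∈ σ ∧
    ∀ u ∈ σ, u ≠ v → dist (S.place σ p) (S.pos σ v) < dist (S.place σ p) (S.pos σ u)}

end PiecewiseFlat

end

/-! The curvature density is constant along each hinge, so everything rests on `scalarDensity_eq`: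
the density is `2 sin ε`. With `A`, `B` the normal vectors of two faces at the hinge, the sum over
an orthonormal basis collapses to `(⟪T A, B⟫ - ⟪T B, A⟫) / area(A, B)`
(`sum_sum_inner_mul_inner_map`). This equals `-2 sin Θ` when `T` rotates the normal plane by `-Θ`,
and `Θ = 2π - ε`.

To find the rotation, each simplex around the hinge carries an orthonormal frame of its normal
plane: the unit normal along its first face, and the perpendicular towards its second face. A
development matches the second face of one simplex with the first face of the next, and the
opposite-side condition fixes the remaining sign, so in these frames it is rotation by minus the
dihedral angle (`IsDevelopment.map_frame`). Angles add along the cycle (`transportAlong_around`),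
and after a full turn the frame is the initial one.

Only hinges containing `v` meet the region of `v`, which leaves a finite sum; the error bound is `|x
- sin x| ≤ |x|³/6`. In dimension three each dual cell cuts an edge at `v` in its half nearer to `v`.
For Voronoi cells this holds because triangles containing their circumcenter are not obtuse. -/

noncomputable section

/-! ### Gram matrices, planar frames and rotations. -/

section LinearAlgebra

variable {E : Type*} [NormedAddCommGroup E] [InnerProductSpace ℝ E]

/-- A linearly independent family can be moved to any family with the same Gram matrix by a linear
isometry of the whole space. -/
theorem exists_linearIsometryEquiv_of_inner_eq [FiniteDimensional ℝ E] {ι : Type*} {b c : ι → E}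
    (hb : LinearIndependent ℝ b) (h : ∀ i j, ⟪b i, b j⟫ = ⟪c i, c j⟫) :
    ∃ L : E ≃ₗᵢ[ℝ] E, ∀ i, L (b i) = c i := by
  classical
  let B := Module.Basis.span hb
  have hB : ∀ i, ((B i : Submodule.span ℝ (Set.range b)) : E) = b i := fun i =>
    congrArg Subtype.val (Module.Basis.span_apply hb i)
  let f : Submodule.span ℝ (Set.range b) →ₗ[ℝ] E := B.constr ℝ c
  have hf : ∀ i, f (B i) = c i := fun i => B.constr_basis ℝ c i
  -- Equal Gram matrices make `f` an isometry on the span of `b`; it then extends to the whole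
  -- finite-dimensional space.
  have key : (innerₗ E).compl₁₂ f f =
      (innerₗ E).compl₁₂ (Submodule.subtype _) (Submodule.subtype _) := by
    refine LinearMap.ext_basis B B fun i j => ?_
    simp [hf, hB, h]
  let g := f.isometryOfInner fun x y => by
    simpa using LinearMap.congr_fun (LinearMap.congr_fun key x) y
  refine ⟨g.extend.toLinearIsometryEquiv rfl, fun i => ?_⟩
  have h1 := g.extend_apply (B i)
  rw [hB] at h1
  simpa [hf] using h1.trans (hf i)

/-- The unit vector in the direction of `u`. -/
def unitVec (u : E) : E := ‖u‖⁻¹ • u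

/-- The unit vector orthogonal to `u` in the half-plane bounded by `u` that contains `w`. -/
def perpVec (u w : E) : E :=
  (Real.sin (InnerProductGeometry.angle u w))⁻¹ •
    (unitVec w - Real.cos (InnerProductGeometry.angle u w) • unitVec u)

theorem norm_unitVec {u : E} (hu : u ≠ 0) : ‖unitVec u‖ = 1 := by
  simp [unitVec, norm_smul, hu]

theorem inner_unitVec_self {u : E} (hu : u ≠ 0) : ⟪unitVec u, unitVec u⟫ = 1 := by
  simp [norm_unitVec hu]

theorem norm_smul_unitVec (u : E) : ‖u‖ • unitVec u = u := by
  rcases eq_or_ne u 0 with rfl | hu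
  · simp
  · rw [unitVec, smul_smul, mul_inv_cancel₀ (norm_ne_zero_iff.2 hu), one_smul]

theorem inner_unitVec_unitVec (u w : E) (hu : u ≠ 0) (hw : w ≠ 0) :
    ⟪unitVec u, unitVec w⟫ = Real.cos (InnerProductGeometry.angle u w) := by
  rw [InnerProductGeometry.cos_angle, unitVec, unitVec, real_inner_smul_left,
    real_inner_smul_right]
  field_simp

theorem unitVec_eq {u w : E} (hs : Real.sin (InnerProductGeometry.angle u w) ≠ 0) :
    unitVec w = Real.cos (InnerProductGeometry.angle u w) • unitVec u +
      Real.sin (InnerProductGeometry.angle u w) • perpVec u w := by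
  rw [perpVec, smul_smul, mul_inv_cancel₀ hs, one_smul]
  abel

theorem inner_unitVec_perpVec {u w : E} (hu : u ≠ 0) (hw : w ≠ 0) :
    ⟪unitVec u, perpVec u w⟫ = 0 := by
  rw [perpVec, real_inner_smul_right, inner_sub_right, real_inner_smul_right,
    inner_unitVec_unitVec u w hu hw, inner_unitVec_self hu]
  simp

theorem inner_perpVec_self {u w : E} (hu : u ≠ 0) (hw : w ≠ 0)
    (hs : Real.sin (InnerProductGeometry.angle u w) ≠ 0) :
    ⟪perpVec u w, perpVec u w⟫ = 1 := by
  have h1 := inner_unitVec_self hw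
  rw [unitVec_eq hs] at h1
  simp only [inner_add_left, inner_add_right, real_inner_smul_left, real_inner_smul_right,
    inner_unitVec_self hu, inner_unitVec_perpVec hu hw,
    real_inner_comm (unitVec u) (perpVec u w)] at h1
  have h2 := Real.sin_sq_add_cos_sq (InnerProductGeometry.angle u w)
  have h3 : Real.sin (InnerProductGeometry.angle u w) ^ 2 ≠ 0 := pow_ne_zero 2 hs
  apply mul_left_cancel₀ h3
  linear_combination h1 - h2

theorem inner_right_perpVec {u w : E} (hu : u ≠ 0) (hw : w ≠ 0)
    (hs : Real.sin (InnerProductGeometry.angle u w) ≠ 0) :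
    ⟪w, perpVec u w⟫ = ‖w‖ * Real.sin (InnerProductGeometry.angle u w) := by
  have h : w = ‖w‖ • (Real.cos (InnerProductGeometry.angle u w) • unitVec u +
      Real.sin (InnerProductGeometry.angle u w) • perpVec u w) := by
    rw [← unitVec_eq hs, norm_smul_unitVec]
  trans ⟪‖w‖ • (Real.cos (InnerProductGeometry.angle u w) • unitVec u +
      Real.sin (InnerProductGeometry.angle u w) • perpVec u w), perpVec u w⟫
  · rw [← h]
  rw [real_inner_smul_left, inner_add_left, real_inner_smul_left, real_inner_smul_left,
    inner_unitVec_perpVec hu hw, inner_perpVec_self hu hw hs]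
  ring

theorem unitVec_mem {P : Submodule ℝ E} {u : E} (hu : u ∈ P) : unitVec u ∈ P :=
  P.smul_mem _ hu

theorem perpVec_mem {P : Submodule ℝ E} {u w : E} (hu : u ∈ P) (hw : w ∈ P) : perpVec u w ∈ P :=
  P.smul_mem _ (P.sub_mem (unitVec_mem hw) (P.smul_mem _ (unitVec_mem hu)))

theorem unitVec_map (L : E ≃ₗᵢ[ℝ] E) (u : E) : L (unitVec u) = unitVec (L u) := by
  simp [unitVec]

/-- The expansion of a vector of a plane in an orthonormal frame. -/
theorem eq_inner_smul_add_of_finrank_eq_two {P : Submodule ℝ E}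
    (hP : Module.finrank ℝ P = 2) {e p : E} (he : e ∈ P) (hp : p ∈ P) (hee : ⟪e, e⟫ = 1)
    (hpp : ⟪p, p⟫ = 1) (hep : ⟪e, p⟫ = 0) {x : E} (hx : x ∈ P) :
    x = ⟪e, x⟫ • e + ⟪p, x⟫ • p := by
  have : FiniteDimensional ℝ P := .of_finrank_pos (by omega)
  let v : Fin 2 → P := ![⟨e, he⟩, ⟨p, hp⟩]
  have hv : Orthonormal ℝ v := by
    rw [orthonormal_iff_ite]
    intro i j
    rw [Submodule.coe_inner]
    fin_cases i <;> fin_cases j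
    · exact hee
    · exact hep
    · exact (real_inner_comm e p).trans hep
    · exact hpp
  let b := (basisOfOrthonormalOfCardEqFinrank hv (by simp [hP])).toOrthonormalBasis
    (by simpa using hv)
  have hb : ∀ i, b i = v i := fun i => by simp [b]
  have := b.sum_repr' ⟨x, hx⟩
  simp only [Fin.sum_univ_two, hb, v] at this
  simpa using (congrArg Subtype.val this).symm

/-- An isometry between planes that matches `w` with the first vector of a frame and puts `u` on
the other side of it rotates the frame of `u, w` by minus the angle between them. -/
theorem map_frame {L : E ≃ₗᵢ[ℝ] E} {P : Submodule ℝ E} (hP : Module.finrank ℝ P = 2)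
    {u w z : E} (hu0 : u ≠ 0) (hw0 : w ≠ 0) (hz0 : z ≠ 0)
    (hs : 0 < Real.sin (InnerProductGeometry.angle u w))
    (hs' : 0 < Real.sin (InnerProductGeometry.angle (L w) z))
    (hu : L u ∈ P) (hw : L w ∈ P) (hz : z ∈ P) (hneg : ⟪L u, perpVec (L w) z⟫ ≤ 0) :
    L (unitVec u) = Real.cos (InnerProductGeometry.angle u w) • unitVec (L w) -
        Real.sin (InnerProductGeometry.angle u w) • perpVec (L w) z ∧
      L (perpVec u w) = Real.sin (InnerProductGeometry.angle u w) • unitVec (L w) +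
        Real.cos (InnerProductGeometry.angle u w) • perpVec (L w) z := by
  have hLw0 : L w ≠ 0 := by simpa using hw0
  set θ := InnerProductGeometry.angle u w
  set e := unitVec (L w)
  set p := perpVec (L w) z
  have hee : ⟪e, e⟫ = 1 := inner_unitVec_self hLw0
  have hpp : ⟪p, p⟫ = 1 := inner_perpVec_self hLw0 hz0 hs'.ne'
  have hep : ⟪e, p⟫ = 0 := inner_unitVec_perpVec hLw0 hz0
  have hx : L (unitVec u) ∈ P := by
    rw [unitVec_map]; exact unitVec_mem hu
  have hexp := eq_inner_smul_add_of_finrank_eq_two hP (unitVec_mem hw) (perpVec_mem hw hz)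
    hee hpp hep hx
  have h1 : ⟪e, L (unitVec u)⟫ = Real.cos θ := by
    rw [show e = L (unitVec w) from (unitVec_map L w).symm, L.inner_map_map, real_inner_comm,
      inner_unitVec_unitVec u w hu0 hw0]
  have h2 : ⟪p, L (unitVec u)⟫ ≤ 0 := by
    rw [unitVec_map, unitVec, real_inner_smul_right, real_inner_comm]
    exact mul_nonpos_of_nonneg_of_nonpos (by positivity) hneg
  have h3 : ⟪L (unitVec u), L (unitVec u)⟫ = 1 := by
    rw [L.inner_map_map, inner_unitVec_self hu0]
  -- Unit length fixes this coordinate up to sign; the side condition `hneg` selects the sign.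
  have h4 : ⟪p, L (unitVec u)⟫ = -Real.sin θ := by
    change L (unitVec u) = ⟪e, L (unitVec u)⟫ • e + ⟪p, L (unitVec u)⟫ • p at hexp
    set y := ⟪p, L (unitVec u)⟫
    rw [h1] at hexp
    rw [hexp] at h3
    simp only [inner_add_left, inner_add_right, real_inner_smul_left, real_inner_smul_right,
      hee, hpp, hep, real_inner_comm e p] at h3
    have h5 := Real.sin_sq_add_cos_sq θ
    have h6 : y ^ 2 = Real.sin θ ^ 2 := by linear_combination h3 - h5
    rcases sq_eq_sq_iff_eq_or_eq_neg.1 h6 with h | h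
    · linarith
    · exact h
  have hfirst : L (unitVec u) = Real.cos θ • e - Real.sin θ • p := by
    rw [hexp]
    change ⟪e, L (unitVec u)⟫ • e + ⟪p, L (unitVec u)⟫ • p = _
    rw [h1, h4]
    module
  refine ⟨hfirst, ?_⟩
  -- The second frame vector needs no new sign choice: apply `L` to the expansion of `unitVec w` and
  -- solve.
  have h7 : Real.sin θ • L (perpVec u w) = e - Real.cos θ • L (unitVec u) := by
    have := congrArg L (unitVec_eq (u := u) (w := w) hs.ne')
    rw [unitVec_map, map_add, map_smul, map_smul] at this
    change e = _ at this
    rw [this]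
    simp [θ]
  apply smul_right_injective E hs.ne'
  simp only
  rw [h7, hfirst]
  have h5 := Real.sin_sq_add_cos_sq θ
  have : e = (Real.sin θ ^ 2 + Real.cos θ ^ 2) • e := by rw [h5, one_smul]
  nth_rewrite 1 [this]
  module

/-- Expanding `x` and `y` in the basis shows that the double sum does not depend on the basis, which
reduces the scalar curvature to the two face normals. -/
theorem sum_sum_inner_mul_inner_map {ι : Type*} [Fintype ι] (b : OrthonormalBasis ι ℝ E)
    (T : E →ₗ[ℝ] E) (x y : E) :
    ∑ i, ∑ j, ⟪x, b i⟫ * ⟪y, b j⟫ * ⟪T (b i), b j⟫ = ⟪T x, y⟫ := by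
  have hx : T x = ∑ i, ⟪x, b i⟫ • T (b i) := by
    conv_lhs => rw [← b.sum_repr' x]
    simp [real_inner_comm]
  rw [hx, sum_inner]
  refine Finset.sum_congr rfl fun i _ => ?_
  rw [real_inner_smul_left, ← b.sum_inner_mul_inner (T (b i)) y, Finset.mul_sum]
  refine Finset.sum_congr rfl fun j _ => ?_
  rw [real_inner_comm (b j) y]
  ring

/-- The trace of a rotation against the oriented area form of its plane. -/
theorem inner_map_sub_inner_map_of_rotation {T : E →ₗ[ℝ] E} {u w : E} (hu : u ≠ 0) (hw : w ≠ 0)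
    (hs : 0 < Real.sin (InnerProductGeometry.angle u w)) {φ : ℝ}
    (h1 : T (unitVec u) = Real.cos φ • unitVec u - Real.sin φ • perpVec u w)
    (h2 : T (perpVec u w) = Real.sin φ • unitVec u + Real.cos φ • perpVec u w) :
    (⟪T u, w⟫ - ⟪T w, u⟫) / Real.sqrt (‖u‖ ^ 2 * ‖w‖ ^ 2 - ⟪u, w⟫ ^ 2) = -2 * Real.sin φ := by
  have hsq : Real.sqrt (‖u‖ ^ 2 * ‖w‖ ^ 2 - ⟪u, w⟫ ^ 2) =
      Real.sin (InnerProductGeometry.angle u w) * (‖u‖ * ‖w‖) := by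
    rw [InnerProductGeometry.sin_angle_mul_norm_mul_norm, real_inner_self_eq_norm_sq,
      real_inner_self_eq_norm_sq, ← sq]
  have hu' : 0 < ‖u‖ := norm_pos_iff.2 hu
  have hw' : 0 < ‖w‖ := norm_pos_iff.2 hw
  rw [hsq, div_eq_iff (by positivity)]
  have hwe := unitVec_eq hs.ne'
  set θ := InnerProductGeometry.angle u w
  set e := unitVec u with he
  set p := perpVec u w with hp
  have hee : ⟪e, e⟫ = 1 := inner_unitVec_self hu
  have hpp : ⟪p, p⟫ = 1 := inner_perpVec_self hu hw hs.ne'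
  have hep : ⟪e, p⟫ = 0 := inner_unitVec_perpVec hu hw
  have hpe : ⟪p, e⟫ = 0 := by rw [real_inner_comm, hep]
  have hu2 : u = ‖u‖ • e := (norm_smul_unitVec u).symm
  have hw2 : w = ‖w‖ • (Real.cos θ • e + Real.sin θ • p) := by rw [← hwe, norm_smul_unitVec]
  have hA : ⟪T u, w⟫ = ⟪T (‖u‖ • e), ‖w‖ • (Real.cos θ • e + Real.sin θ • p)⟫ := by
    rw [← hu2, ← hw2]
  have hB : ⟪T w, u⟫ = ⟪T (‖w‖ • (Real.cos θ • e + Real.sin θ • p)), ‖u‖ • e⟫ := by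
    rw [← hu2, ← hw2]
  rw [hA, hB]
  simp only [map_smul, map_add, h1, h2, inner_add_left, inner_add_right, inner_sub_left,
    real_inner_smul_left, real_inner_smul_right, hee, hpp, hep, hpe]
  ring

theorem linearIsometryEquiv_sub (g : E ≃ᵃⁱ[ℝ] E) (x y : E) :
    g.linearIsometryEquiv (x - y) = g x - g y :=
  g.map_vsub x y

end LinearAlgebra

/-! ### Faces of affinely independent families. -/

section AffineIndependence

variable {V E : Type*} [NormedAddCommGroup E] [InnerProductSpace ℝ E]

theorem notMem_affineSpan_image_of_subset {p : V → E} {σ τ : Finset V}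
    (hi : AffineIndependent ℝ fun v : σ => p v) (hτ : τ ⊆ σ) {a : V} (ha : a ∈ σ) (haτ : a ∉ τ) :
    p a ∉ affineSpan ℝ (p '' τ) := by
  have h := hi.mem_affineSpan_iff ⟨a, ha⟩ {v | v.1 ∈ τ}
  have himg : (fun v : σ => p v) '' {v | v.1 ∈ τ} = p '' τ := by
    ext x
    constructor
    · rintro ⟨v, hv, rfl⟩
      exact ⟨v, hv, rfl⟩
    · rintro ⟨v, hv, rfl⟩
      exact ⟨⟨v, hτ hv⟩, hv, rfl⟩
  rw [himg] at h
  exact fun h' => haτ (h.1 h')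

theorem finrank_vectorSpan_image_of_subset {p : V → E} {σ τ : Finset V}
    (hi : AffineIndependent ℝ fun v : σ => p v) (hτ : τ ⊆ σ) {m : ℕ} (hc : τ.card = m + 1) :
    Module.finrank ℝ (vectorSpan ℝ (p '' τ)) = m := by
  have h : AffineIndependent ℝ fun v : τ => p v :=
    hi.comp_embedding ⟨fun v : τ => (⟨v.1, hτ v.2⟩ : σ), fun v w hvw =>
      Subtype.ext (congrArg (fun x : σ => x.1) hvw)⟩
  rw [Set.image_eq_range]
  exact h.finrank_vectorSpan (by simpa using hc)

end AffineIndependence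

/-! ### Congruences and sides of a hyperplane. -/

section Congruence

variable {V E : Type*} [NormedAddCommGroup E] [InnerProductSpace ℝ E] [FiniteDimensional ℝ E]

/-- Congruent affinely independent families differ by an isometry of the whole space. -/
theorem exists_affineIsometryEquiv_of_dist_eq {p q : V → E} {F : Finset V} (hF : F.Nonempty)
    (hp : AffineIndependent ℝ fun v : F => p v)
    (hd : ∀ u ∈ F, ∀ w ∈ F, dist (p u) (p w) = dist (q u) (q w)) :
    ∃ g : E ≃ᵃⁱ[ℝ] E, ∀ v ∈ F, g (p v) = q v := by
  obtain ⟨v₀, hv₀⟩ := hF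
  rw [affineIndependent_iff_linearIndependent_vsub ℝ _ (⟨v₀, hv₀⟩ : F)] at hp
  -- By polarization the mutual distances determine the Gram matrix of the edge vectors at `v₀`.
  obtain ⟨L, hL⟩ := exists_linearIsometryEquiv_of_inner_eq
    (c := fun i : {x : F // x ≠ ⟨v₀, hv₀⟩} => q i.1 -ᵥ q v₀) hp fun i j => by
      simp only [vsub_eq_sub,
        real_inner_eq_norm_mul_self_add_norm_mul_self_sub_norm_sub_mul_self_div_two,
        sub_sub_sub_cancel_right, ← dist_eq_norm]
      rw [hd _ i.1.2 _ hv₀, hd _ j.1.2 _ hv₀, hd _ i.1.2 _ j.1.2]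
  refine ⟨AffineIsometryEquiv.mk' (fun x => L (x -ᵥ p v₀) +ᵥ q v₀) L (p v₀) (by simp),
    fun v hv => ?_⟩
  by_cases h : v = v₀
  · simp [h]
  · have := hL ⟨⟨v, hv⟩, fun h' => h (congrArg Subtype.val h')⟩
    simp only [vsub_eq_sub] at this
    change L (p v - p v₀) + q v₀ = q v
    rw [this, sub_add_cancel]

/-- Two points off a hyperplane lie on opposite sides of it, possibly after reflecting one. -/
theorem sOppSide_or_sOppSide_reflection {s : AffineSubspace ℝ E} [Nonempty s]
    (hs : Module.finrank ℝ s.direction + 1 = Module.finrank ℝ E) {x y : E} (hx : x ∉ s)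
    (hy : y ∉ s) : s.SOppSide x y ∨ s.SOppSide (EuclideanGeometry.reflection s x) y := by
  have h1 : Module.finrank ℝ s.directionᗮ = 1 := Submodule.finrank_add_finrank_orthogonal' hs
  obtain ⟨m, -, hm⟩ := finrank_eq_one_iff'.1 h1
  obtain ⟨f, hf⟩ := (inferInstance : Nonempty s)
  -- The normal coordinate `c` tells the side of the hyperplane, and reflection negates it.
  have key : ∀ z : E, ∃ c : ℝ, ∃ k ∈ s.direction, z = k + c • (m : E) + f := fun z => by
    obtain ⟨k, hk, l, hl, hkl⟩ := s.direction.exists_add_mem_mem_orthogonal (z - f)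
    obtain ⟨c, hc⟩ := hm ⟨l, hl⟩
    refine ⟨c, k, hk, ?_⟩
    have : c • (m : E) = l := congrArg Subtype.val hc
    rw [this, ← hkl, sub_add_cancel]
  obtain ⟨c₁, k₁, hk₁, rfl⟩ := key x
  obtain ⟨c₂, k₂, hk₂, rfl⟩ := key y
  have hmem : ∀ k ∈ s.direction, k + f ∈ s := fun k hk =>
    AffineSubspace.vadd_mem_of_mem_direction hk hf
  have hrefl : EuclideanGeometry.reflection s (k₁ + c₁ • (m : E) + f) =
      k₁ + (-c₁) • (m : E) + f := by
    have := EuclideanGeometry.reflection_orthogonal_vadd (hmem k₁ hk₁)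
      (s.directionᗮ.smul_mem c₁ m.2)
    rw [vadd_eq_add, vadd_eq_add] at this
    rw [show k₁ + c₁ • (m : E) + f = c₁ • (m : E) + (k₁ + f) by abel, this]
    module
  rcases le_or_gt (c₁ * c₂) 0 with hc | hc
  · left
    exact AffineSubspace.sOppSide_of_vsub_eq_smul (m := (m : E)) (hmem k₁ hk₁) (hmem k₂ hk₂)
      (by simp only [vsub_eq_sub]; abel) (by simp only [vsub_eq_sub]; abel) hc hx hy
  · right
    have hx' : EuclideanGeometry.reflection s (k₁ + c₁ • (m : E) + f) ∉ s := fun h => hx (by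
      have := (EuclideanGeometry.reflection_eq_self_iff _).2 h
      rw [EuclideanGeometry.reflection_reflection] at this
      rwa [this])
    rw [hrefl] at hx' ⊢
    exact AffineSubspace.sOppSide_of_vsub_eq_smul (m := (m : E)) (c₁ := -c₁) (hmem k₁ hk₁)
      (hmem k₂ hk₂) (by simp only [vsub_eq_sub]; abel) (by simp only [vsub_eq_sub]; abel)
      (by linarith) hx' hy

/-- Reflection in the hyperplane of the target face fixes that face, so a congruence on the wrong
side can be corrected by composing with it. -/
theorem exists_affineIsometryEquiv_sOppSide {p q : V → E} {F : Finset V} (hF : F.Nonempty)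
    (hp : AffineIndependent ℝ fun v : F => p v)
    (hq : Module.finrank ℝ (vectorSpan ℝ (q '' F)) + 1 = Module.finrank ℝ E)
    (hd : ∀ u ∈ F, ∀ w ∈ F, dist (p u) (p w) = dist (q u) (q w)) {x y : E}
    (hx : x ∉ affineSpan ℝ (p '' F)) (hy : y ∉ affineSpan ℝ (q '' F)) :
    ∃ g : E ≃ᵃⁱ[ℝ] E, (∀ v ∈ F, g (p v) = q v) ∧ (affineSpan ℝ (q '' F)).SOppSide (g x) y := by
  obtain ⟨g, hg⟩ := exists_affineIsometryEquiv_of_dist_eq hF hp hd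
  have himg : q '' F = g.toAffineEquiv.toAffineMap '' (p '' F) := by
    rw [Set.image_image]
    exact Set.image_congr fun v hv => (hg v hv).symm
  have hgx : g x ∉ affineSpan ℝ (q '' F) := by
    rw [himg, ← AffineSubspace.map_span]
    exact fun h => hx ((AffineSubspace.mem_map_iff_mem_of_injective
      (f := g.toAffineEquiv.toAffineMap) g.injective).1 h)
  have hne : Nonempty (affineSpan ℝ (q '' F)) := by
    obtain ⟨v, hv⟩ := hF
    exact ⟨⟨q v, subset_affineSpan ℝ _ ⟨v, hv, rfl⟩⟩⟩
  rcases sOppSide_or_sOppSide_reflection (by rwa [direction_affineSpan]) hgx hy with h | h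
  · exact ⟨g, hg, h⟩
  · refine ⟨g.trans (EuclideanGeometry.reflection (affineSpan ℝ (q '' F))), fun v hv => ?_, h⟩
    rw [AffineIsometryEquiv.coe_trans, Function.comp_apply, hg v hv,
      EuclideanGeometry.reflection_eq_self_iff]
    exact subset_affineSpan ℝ _ ⟨v, hv, rfl⟩

end Congruence

namespace PiecewiseFlat

variable {n : ℕ} {V : Type*} [DecidableEq V] (S : PiecewiseFlat n V)

/-! ### Normal vectors -/

/-- The centroid and any vertex of `h` differ by a direction of `h`, which the projection kills.
Vertices are convenient because developments match them. -/
theorem normalVec_eq {σ h : Finset V} {v : V} (hv : v ∈ h) (a : V) :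
    S.normalVec σ h a =
      ((vectorSpan ℝ (S.pos σ '' h))ᗮ).starProjection (S.pos σ a - S.pos σ v) := by
  have hc : h.centroid ℝ (S.pos σ) ∈ affineSpan ℝ (S.pos σ '' h) := by
    rw [Finset.centroid_def]
    exact affineCombination_mem_affineSpan_image
      (h.sum_centroidWeights_eq_one_of_nonempty ℝ ⟨v, hv⟩) (fun i hi hi' => absurd hi hi') _
  have hmem : h.centroid ℝ (S.pos σ) - S.pos σ v ∈ vectorSpan ℝ (S.pos σ '' h) := by
    rw [← direction_affineSpan]
    exact AffineSubspace.vsub_mem_direction hc (subset_affineSpan ℝ _ ⟨v, hv, rfl⟩)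
  have h0 : ((vectorSpan ℝ (S.pos σ '' h))ᗮ).starProjection
      (h.centroid ℝ (S.pos σ) - S.pos σ v) = 0 := by
    rw [Submodule.starProjection_apply_eq_zero_iff, Submodule.orthogonal_orthogonal]
    exact hmem
  rw [normalVec, vsub_eq_sub,
    show S.pos σ a - S.pos σ v = (S.pos σ a - h.centroid ℝ (S.pos σ)) +
      (h.centroid ℝ (S.pos σ) - S.pos σ v) by abel, map_add, h0, add_zero]

theorem normalVec_mem (σ h : Finset V) (a : V) :
    S.normalVec σ h a ∈ (vectorSpan ℝ (S.pos σ '' h))ᗮ :=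
  Submodule.starProjection_apply_mem _ _

theorem sub_sub_normalVec_mem {σ h : Finset V} {v : V} (hv : v ∈ h) (a : V) :
    S.pos σ a - S.pos σ v - S.normalVec σ h a ∈ vectorSpan ℝ (S.pos σ '' h) := by
  rw [S.normalVec_eq hv, Submodule.starProjection_orthogonal, _root_.sub_apply,
    ContinuousLinearMap.id_apply, sub_sub_cancel]
  exact Submodule.starProjection_apply_mem _ _

variable {S}

theorem pos_sub_pos_mem (σ : Finset V) {h : Finset V} {u v : V} (hu : u ∈ h) (hv : v ∈ h) :
    S.pos σ u - S.pos σ v ∈ vectorSpan ℝ (S.pos σ '' h) :=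
  vsub_mem_vectorSpan ℝ (Set.mem_image_of_mem _ hu) (Set.mem_image_of_mem _ hv)

theorem normalVec_ne_zero {σ h : Finset V} (hσ : σ ∈ S.facets) (hh : h.Nonempty) (hhσ : h ⊆ σ)
    {a : V} (ha : a ∈ σ) (hah : a ∉ h) : S.normalVec σ h a ≠ 0 := by
  obtain ⟨v, hv⟩ := hh
  intro h0
  have h1 := S.sub_sub_normalVec_mem (σ := σ) hv a
  rw [h0, sub_zero] at h1
  refine notMem_affineSpan_image_of_subset (S.affineIndependent σ hσ) hhσ ha hah ?_
  have := AffineSubspace.vadd_mem_of_mem_direction (s := affineSpan ℝ (S.pos σ '' h))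
    (by rwa [direction_affineSpan]) (subset_affineSpan ℝ _ ⟨v, hv, rfl⟩)
  simpa using this

/-- A vanishing sine would make the normal of `b` a multiple of that of `a`, placing `b` in the
affine span of `h ∪ {a}`, against affine independence. -/
theorem sin_angle_normalVec_pos {σ h : Finset V} (hσ : σ ∈ S.facets) (hh : h.Nonempty)
    (hhσ : h ⊆ σ) {a b : V} (ha : a ∈ σ) (hb : b ∈ σ) (hbh : b ∉ h) (hab : a ≠ b) :
    0 < Real.sin (InnerProductGeometry.angle (S.normalVec σ h a) (S.normalVec σ h b)) := by
  obtain ⟨v, hv⟩ := hh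
  have key : ∀ r : ℝ, S.normalVec σ h b ≠ r • S.normalVec σ h a := by
    intro r hr
    refine notMem_affineSpan_image_of_subset (τ := insert a h) (S.affineIndependent σ hσ)
      (Finset.insert_subset ha hhσ) hb (by simp [hbh, hab.symm]) ?_
    have hmono : vectorSpan ℝ (S.pos σ '' h) ≤
        vectorSpan ℝ (S.pos σ '' (insert a h : Finset V)) :=
      vectorSpan_mono ℝ (Set.image_mono (by simp))
    have h1 := hmono (S.sub_sub_normalVec_mem (σ := σ) hv a)
    have h2 := hmono (S.sub_sub_normalVec_mem (σ := σ) hv b)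
    have h3 := pos_sub_pos_mem (S := S) σ (Finset.mem_insert_self a h)
      (Finset.mem_insert_of_mem hv)
    have h4 := Submodule.add_mem _ (Submodule.sub_mem _ h2 (Submodule.smul_mem _ r h1))
      (Submodule.smul_mem _ r h3)
    rw [hr, show S.pos σ b - S.pos σ v - r • S.normalVec σ h a -
      r • (S.pos σ a - S.pos σ v - S.normalVec σ h a) + r • (S.pos σ a - S.pos σ v) =
      S.pos σ b - S.pos σ v by module] at h4
    have := AffineSubspace.vadd_mem_of_mem_direction
      (s := affineSpan ℝ (S.pos σ '' (insert a h : Finset V)))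
      (by rwa [direction_affineSpan])
      (subset_affineSpan ℝ _ ⟨v, Finset.mem_coe.2 (Finset.mem_insert_of_mem hv), rfl⟩)
    simpa using this
  refine lt_of_le_of_ne (InnerProductGeometry.sin_angle_nonneg _ _) fun h0 => ?_
  rcases InnerProductGeometry.sin_eq_zero_iff_angle_eq_zero_or_angle_eq_pi.1 h0.symm with h | h
  · obtain ⟨-, r, -, hr⟩ := InnerProductGeometry.angle_eq_zero_iff.1 h
    exact key r hr
  · obtain ⟨-, r, -, hr⟩ := InnerProductGeometry.angle_eq_pi_iff.1 h
    exact key r hr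

theorem finrank_normal {σ h : Finset V} (hσ : σ ∈ S.facets) (hhσ : h ⊆ σ) (hh : h.Nonempty)
    (hc : h.card + 1 = n) :
    Module.finrank ℝ ((vectorSpan ℝ (S.pos σ '' h))ᗮ : Submodule ℝ (EuclideanSpace ℝ (Fin n))) =
      2 := by
  obtain ⟨m, hm⟩ := Nat.exists_eq_add_of_lt hh.card_pos
  have h1 := finrank_vectorSpan_image_of_subset (S.affineIndependent σ hσ) hhσ
    (m := m) (by omega)
  refine Submodule.finrank_add_finrank_orthogonal' ?_
  rw [h1, finrank_euclideanSpace_fin]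
  omega

/-! ### Developments -/

/-- Needed because `transport` defaults to the identity when no development exists. -/
theorem exists_isDevelopment {F : Finset V} (hF : F.Nonempty) {a b : V} (ha : a ∉ F) (hb : b ∉ F)
    (hab : a ≠ b) (hσ : insert a F ∈ S.facets) (hτ : insert b F ∈ S.facets) :
    ∃ g, S.IsDevelopment (insert a F) (insert b F) g := by
  have hinter : insert a F ∩ insert b F = F := by
    ext x; simp only [Finset.mem_inter, Finset.mem_insert]; grind
  have hcard : F.card = n := by
    have := S.card_facet _ hσ
    rw [Finset.card_insert_of_notMem ha] at this
    omega
  obtain ⟨m, hm⟩ := Nat.exists_eq_add_of_lt hF.card_pos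
  have hp : AffineIndependent ℝ fun v : F => S.pos (insert a F) v :=
    (S.affineIndependent _ hσ).comp_embedding
      ⟨fun v : F => (⟨v.1, Finset.mem_insert_of_mem v.2⟩ : (insert a F : Finset V)),
        fun v w hvw => Subtype.ext (congrArg (fun x : (insert a F : Finset V) => x.1) hvw)⟩
  have hq := finrank_vectorSpan_image_of_subset (S.affineIndependent _ hτ)
    (Finset.subset_insert b F) (m := m) (by omega)
  obtain ⟨g, hg1, hg2⟩ := exists_affineIsometryEquiv_sOppSide hF hp
    (by rw [hq, finrank_euclideanSpace_fin]; omega)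
    (fun u hu w hw => S.compat _ hσ _ hτ u (by rwa [hinter]) w (by rwa [hinter]))
    (notMem_affineSpan_image_of_subset (S.affineIndependent _ hσ) (Finset.subset_insert a F)
      (Finset.mem_insert_self a F) ha)
    (notMem_affineSpan_image_of_subset (S.affineIndependent _ hτ) (Finset.subset_insert b F)
      (Finset.mem_insert_self b F) hb)
  refine ⟨g, fun v hv => hg1 v (by rwa [hinter] at hv), fun c hc d hd => ?_⟩
  have hca : c = a := by simp only [Finset.mem_sdiff, Finset.mem_insert] at hc; grind
  have hdb : d = b := by simp only [Finset.mem_sdiff, Finset.mem_insert] at hd; grind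
  rw [hinter, hca, hdb]
  exact hg2

/-- The facts below hold for every development, so the choice made in `transport` does not matter.
-/
theorem exists_transport_eq {σ τ : Finset V} (h : ∃ g, S.IsDevelopment σ τ g) :
    ∃ g, S.IsDevelopment σ τ g ∧ S.transport σ τ = g.linearIsometryEquiv :=
  ⟨h.choose, h.choose_spec, by rw [transport, dif_pos h]⟩

theorem IsDevelopment.map_vectorSpan {σ τ h : Finset V}
    {g : EuclideanSpace ℝ (Fin n) ≃ᵃⁱ[ℝ] EuclideanSpace ℝ (Fin n)}
    (hg : S.IsDevelopment σ τ g) (hh : h ⊆ σ ∩ τ) :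
    (vectorSpan ℝ (S.pos σ '' h)).map (g.linearIsometryEquiv.toLinearEquiv : _ →ₗ[ℝ] _) =
      vectorSpan ℝ (S.pos τ '' h) := by
  have himg : S.pos τ '' h = g.toAffineEquiv.toAffineMap '' (S.pos σ '' h) := by
    rw [Set.image_image]
    exact Set.image_congr fun v hv => (hg.1 v (hh hv)).symm
  rw [himg, ← AffineMap.map_vectorSpan]
  rfl

theorem IsDevelopment.map_normalVec {σ τ h : Finset V}
    {g : EuclideanSpace ℝ (Fin n) ≃ᵃⁱ[ℝ] EuclideanSpace ℝ (Fin n)}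
    (hg : S.IsDevelopment σ τ g) (hne : h.Nonempty) (hh : h ⊆ σ ∩ τ) {b : V} (hb : b ∈ σ ∩ τ) :
    g.linearIsometryEquiv (S.normalVec σ h b) = S.normalVec τ h b := by
  obtain ⟨v, hv⟩ := hne
  have h1 := g.linearIsometryEquiv.toLinearIsometry.map_starProjection
    ((vectorSpan ℝ (S.pos σ '' h))ᗮ) (S.pos σ b - S.pos σ v)
  have h2 : ((vectorSpan ℝ (S.pos σ '' h))ᗮ).map
      g.linearIsometryEquiv.toLinearIsometry.toLinearMap = (vectorSpan ℝ (S.pos τ '' h))ᗮ := by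
    rw [← hg.map_vectorSpan hh]
    exact Submodule.map_orthogonal_equiv _ _
  rw [S.normalVec_eq hv, S.normalVec_eq hv, ← hg.1 b hb, ← hg.1 v (hh hv), ← linearIsometryEquiv_sub]
  simp only [h2] at h1
  exact h1

/-- A development turns the frame of the faces at a hinge by minus the dihedral angle. -/
theorem IsDevelopment.map_frame {h : Finset V} (hne : h.Nonempty) (hc : h.card + 1 = n)
    {a b c : V} (hσ : insert a (insert b h) ∈ S.facets) (hτ : insert b (insert c h) ∈ S.facets)
    (hac : a ≠ c) {g : EuclideanSpace ℝ (Fin n) ≃ᵃⁱ[ℝ] EuclideanSpace ℝ (Fin n)}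
    (hg : S.IsDevelopment (insert a (insert b h)) (insert b (insert c h)) g) {θ : ℝ}
    (hθ : θ = S.dihedralAngle (insert a (insert b h)) h a b) :
    g.linearIsometryEquiv (unitVec (S.normalVec (insert a (insert b h)) h a)) =
        Real.cos θ • unitVec (S.normalVec (insert b (insert c h)) h b) -
          Real.sin θ • perpVec (S.normalVec (insert b (insert c h)) h b)
            (S.normalVec (insert b (insert c h)) h c) ∧
      g.linearIsometryEquiv (perpVec (S.normalVec (insert a (insert b h)) h a)
          (S.normalVec (insert a (insert b h)) h b)) =
        Real.sin θ • unitVec (S.normalVec (insert b (insert c h)) h b) +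
          Real.cos θ • perpVec (S.normalVec (insert b (insert c h)) h b)
            (S.normalVec (insert b (insert c h)) h c) := by
  have hcσ := S.card_facet _ hσ
  have hcτ := S.card_facet _ hτ
  have hbh : b ∉ h := by
    intro hb
    rw [Finset.insert_eq_of_mem hb] at hcσ
    have := Finset.card_insert_le a h
    omega
  have habh : a ∉ insert b h := by
    intro ha
    rw [Finset.insert_eq_of_mem ha] at hcσ
    have := Finset.card_insert_le b h
    omega
  have hch : c ∉ h := by
    intro hb
    rw [Finset.insert_eq_of_mem hb] at hcτ
    have := Finset.card_insert_le b h
    omega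
  have hbch : b ∉ insert c h := by
    intro ha
    rw [Finset.insert_eq_of_mem ha] at hcτ
    have := Finset.card_insert_le c h
    omega
  simp only [Finset.mem_insert, not_or] at habh hbch
  obtain ⟨hab, hah⟩ := habh
  obtain ⟨hbc, -⟩ := hbch
  set σ := insert a (insert b h) with hσ_def
  set τ := insert b (insert c h) with hτ_def
  have hhσ : h ⊆ σ := by intro x hx; simp [hσ_def, hx]
  have hhτ : h ⊆ τ := by intro x hx; simp [hτ_def, hx]
  have haσ : a ∈ σ := by simp [hσ_def]
  have hbσ : b ∈ σ := by simp [hσ_def]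
  have hbτ : b ∈ τ := by simp [hτ_def]
  have hcτ' : c ∈ τ := by simp [hτ_def]
  have hbst : b ∈ σ ∩ τ := Finset.mem_inter.2 ⟨hbσ, hbτ⟩
  have hst : h ⊆ σ ∩ τ := Finset.subset_inter hhσ hhτ
  have hLb := hg.map_normalVec hne hst hbst
  have hLmem : ∀ x ∈ (vectorSpan ℝ (S.pos σ '' h))ᗮ,
      g.linearIsometryEquiv x ∈ (vectorSpan ℝ (S.pos τ '' h))ᗮ := fun x hx => by
    rw [← hg.map_vectorSpan hst, ← Submodule.map_orthogonal_equiv]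
    exact Submodule.mem_map_of_mem hx
  have hsσ := sin_angle_normalVec_pos hσ hne hhσ haσ hbσ hbh hab
  have hsτ := sin_angle_normalVec_pos hτ hne hhτ hbτ hcτ' hch hbc
  have hb0 := normalVec_ne_zero hτ hne hhτ hbτ hbh
  have hc0 := normalVec_ne_zero hτ hne hhτ hcτ' hch
  rw [hθ, dihedralAngle, ← hLb]
  refine _root_.map_frame (finrank_normal hτ hhτ hne hc)
    (normalVec_ne_zero hσ hne hhσ haσ hah) (normalVec_ne_zero hσ hne hhσ hbσ hbh) hc0
    hsσ (by rwa [hLb]) (hLmem _ (S.normalVec_mem _ _ _)) (by rw [hLb]; exact S.normalVec_mem _ _ _)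
    (S.normalVec_mem _ _ _) ?_
  rw [hLb]
  set p := perpVec (S.normalVec τ h b) (S.normalVec τ h c) with hp_def
  obtain ⟨v, hv⟩ := hne
  have hpK : ∀ k ∈ vectorSpan ℝ (S.pos τ '' h), ⟪k, p⟫ = 0 := fun k hk =>
    (perpVec_mem (S.normalVec_mem τ h b) (S.normalVec_mem τ h c)) k hk
  have hpb : ⟪S.normalVec τ h b, p⟫ = 0 := by
    have := inner_unitVec_perpVec hb0 hc0
    rw [← norm_smul_unitVec (S.normalVec τ h b), real_inner_smul_left, this,
      mul_zero]
  have hpc : 0 < ⟪S.normalVec τ h c, p⟫ := by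
    rw [inner_right_perpVec hb0 hc0 hsτ.ne']
    have := norm_pos_iff.2 hc0
    positivity
  have hpos : ∀ d, ⟪S.pos τ d - S.pos τ v, p⟫ = ⟪S.normalVec τ h d, p⟫ := fun d => by
    have := hpK _ (S.sub_sub_normalVec_mem (σ := τ) hv d)
    rwa [inner_sub_left, sub_eq_zero] at this
  -- `p` is normal to the common face, which is spanned by `h` and `b`; its pairing therefore
  -- measures the side of that face.
  have hface : ∀ x ∈ affineSpan ℝ (S.pos τ '' (σ ∩ τ : Finset V)),
      ⟪x - S.pos τ v, p⟫ = 0 := by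
    intro x hx
    have hle : affineSpan ℝ (S.pos τ '' (σ ∩ τ : Finset V)) ≤
        AffineSubspace.mk' (S.pos τ v) (Submodule.span ℝ {p})ᗮ := by
      rw [affineSpan_le]
      rintro _ ⟨d, hd, rfl⟩
      rw [SetLike.mem_coe, AffineSubspace.mem_mk', vsub_eq_sub,
        Submodule.mem_orthogonal_singleton_iff_inner_left]
      have hd' : d = b ∨ d ∈ h := by
        simp only [hσ_def, hτ_def, Finset.coe_inter, Set.mem_inter_iff, Finset.mem_coe,
          Finset.mem_insert] at hd
        grind
      rcases hd' with rfl | hd'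
      · rw [hpos, hpb]
      · exact hpK _ (pos_sub_pos_mem τ hd' hv)
    have := hle hx
    rwa [AffineSubspace.mem_mk', vsub_eq_sub,
      Submodule.mem_orthogonal_singleton_iff_inner_left] at this
  have hLa : ⟪g.linearIsometryEquiv (S.normalVec σ h a), p⟫ = ⟪g (S.pos σ a) - S.pos τ v, p⟫ := by
    have h1 := S.sub_sub_normalVec_mem (σ := σ) hv a
    have h2 := Submodule.mem_map_of_mem
      (f := (g.linearIsometryEquiv.toLinearEquiv :
        EuclideanSpace ℝ (Fin n) →ₗ[ℝ] EuclideanSpace ℝ (Fin n))) h1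
    rw [hg.map_vectorSpan hst] at h2
    have h3 := hpK _ h2
    change ⟪g.linearIsometryEquiv (S.pos σ a - S.pos σ v - S.normalVec σ h a), p⟫ = 0 at h3
    rw [map_sub, linearIsometryEquiv_sub, inner_sub_left, sub_eq_zero, hg.1 v (hst hv)] at h3
    exact h3.symm
  obtain ⟨⟨p₁, hp₁, p₂, hp₂, hray⟩, -, -⟩ := hg.2 a
    (by simp only [hσ_def, hτ_def, Finset.mem_sdiff, Finset.mem_insert]; grind) c
    (by simp only [hσ_def, hτ_def, Finset.mem_sdiff, Finset.mem_insert]; grind)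
  -- Paired with `p`, the same-ray condition becomes one between real numbers, the second being
  -- `-⟪normalVec τ h c, p⟫ < 0`; so the first cannot be positive.
  have h1 := hray.map (innerₗ (EuclideanSpace ℝ (Fin n)) p)
  have e1 : ⟪p, g (S.pos σ a) - p₁⟫ = ⟪g (S.pos σ a) - S.pos τ v, p⟫ := by
    rw [real_inner_comm, ← sub_sub_sub_cancel_right _ _ (S.pos τ v), inner_sub_left,
      hface _ hp₁, sub_zero]
  have e2 : ⟪p, p₂ - S.pos τ c⟫ = -⟪S.normalVec τ h c, p⟫ := by
    rw [real_inner_comm, ← sub_sub_sub_cancel_right _ _ (S.pos τ v), inner_sub_left,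
      hface _ hp₂, hpos, zero_sub]
  simp only [vsub_eq_sub, innerₗ_apply_apply, e1, e2] at h1
  rw [hLa]
  by_contra! hpos'
  rcases h1 with h1 | h1 | ⟨r, s, hr, hs, h1⟩
  · linarith
  · linarith
  · simp only [smul_eq_mul] at h1
    nlinarith [mul_pos hr hpos', mul_pos hs hpc]

end PiecewiseFlat

/-! ### Cyclic indexing of the star of a hinge. -/

theorem LinkCycle.vert_mod {V : Type*} [DecidableEq V] {facets : Set (Finset V)} {h : Finset V}
    (c : LinkCycle facets h) (i : ℕ) : c.vert (i % c.len) = c.vert i :=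
  Function.Periodic.map_mod_nat c.periodic i

theorem LinkCycle.mem_facets {V : Type*} [DecidableEq V] {facets : Set (Finset V)} {h : Finset V}
    (c : LinkCycle facets h) (i : ℕ) :
    insert (c.vert i) (insert (c.vert (i + 1)) h) ∈ facets := by
  have hlt : i % c.len < c.len := Nat.mod_lt _ (by have := c.three_le; omega)
  have h1 := ((c.star _).2 ⟨i % c.len, hlt, rfl⟩).1
  rwa [c.vert_mod, ← c.vert_mod (i % c.len + 1), Nat.mod_add_mod, c.vert_mod] at h1

/-- A coincidence would force `len ∣ 2`, which `three_le` excludes. This makes the two vertices off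
the common face of consecutive simplices distinct. -/
theorem LinkCycle.vert_ne {V : Type*} [DecidableEq V] {facets : Set (Finset V)} {h : Finset V}
    (c : LinkCycle facets h) (i : ℕ) : c.vert i ≠ c.vert (i + 2) := by
  intro he
  have hlen := c.three_le
  rw [← c.vert_mod i, ← c.vert_mod (i + 2)] at he
  have h1 : i ≡ i + 2 [MOD c.len] :=
    c.injOn (Nat.mod_lt _ (by omega)) (Nat.mod_lt _ (by omega)) he
  have h2 := (Nat.modEq_iff_dvd' (by omega)).1 h1
  have h3 := Nat.le_of_dvd (by omega) h2
  omega

namespace PiecewiseFlat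

variable {n : ℕ} {V : Type*} [DecidableEq V] (S : PiecewiseFlat n V)

/-! ### Holonomy and scalar curvature -/

theorem Hinge.nonempty {S : PiecewiseFlat n V} (hn : 2 ≤ n) (h : S.Hinge) : h.1.Nonempty := by
  have := h.2.1
  exact Finset.card_pos.1 (by omega)

theorem around_mem_facets (h : S.Hinge) (i : ℕ) : S.around h i ∈ S.facets :=
  (S.cycle h).mem_facets i

theorem subset_around (h : S.Hinge) (i : ℕ) : h.1 ⊆ S.around h i := fun x hx => by
  simp [around, hx]

theorem around_len (h : S.Hinge) : S.around h (S.cycle h).len = S.around h 0 := by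
  have h0 := (S.cycle h).periodic 0
  have h1 := (S.cycle h).periodic 1
  rw [add_comm] at h1
  rw [zero_add] at h0
  rw [around, around, h0, h1]

/-- The normal vector of the first face of the `i`-th simplex around a hinge. -/
def firstNormal (h : S.Hinge) (i : ℕ) : EuclideanSpace ℝ (Fin n) :=
  S.normalVec (S.around h i) h.1 ((S.cycle h).vert i)

/-- The normal vector of the second face of the `i`-th simplex around a hinge. -/
def secondNormal (h : S.Hinge) (i : ℕ) : EuclideanSpace ℝ (Fin n) :=
  S.normalVec (S.around h i) h.1 ((S.cycle h).vert (i + 1))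

theorem firstNormal_len (h : S.Hinge) :
    S.firstNormal h (S.cycle h).len = S.firstNormal h 0 := by
  have h0 := (S.cycle h).periodic 0
  rw [zero_add] at h0
  rw [firstNormal, firstNormal, around_len, h0]

theorem secondNormal_len (h : S.Hinge) :
    S.secondNormal h (S.cycle h).len = S.secondNormal h 0 := by
  have h1 := (S.cycle h).periodic 1
  rw [add_comm] at h1
  rw [secondNormal, secondNormal, around_len, h1]

theorem transport_around (hn : 2 ≤ n) (h : S.Hinge) (i : ℕ) {θ : ℝ}
    (hθ : θ = InnerProductGeometry.angle (S.firstNormal h i) (S.secondNormal h i)) :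
    S.transport (S.around h i) (S.around h (i + 1)) (unitVec (S.firstNormal h i)) =
        Real.cos θ • unitVec (S.firstNormal h (i + 1)) -
          Real.sin θ • perpVec (S.firstNormal h (i + 1)) (S.secondNormal h (i + 1)) ∧
      S.transport (S.around h i) (S.around h (i + 1))
          (perpVec (S.firstNormal h i) (S.secondNormal h i)) =
        Real.sin θ • unitVec (S.firstNormal h (i + 1)) +
          Real.cos θ • perpVec (S.firstNormal h (i + 1)) (S.secondNormal h (i + 1)) := by
  have hne := h.nonempty hn
  have hc := h.2.1
  have hσ := S.around_mem_facets h i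
  have hτ := S.around_mem_facets h (i + 1)
  have hac := (S.cycle h).vert_ne i
  have hcσ := S.card_facet _ hσ
  have hcτ := S.card_facet _ hτ
  have hex : ∃ g, S.IsDevelopment (S.around h i) (S.around h (i + 1)) g := by
    -- Both simplices are displayed as one vertex inserted into their common face.
    have hcomm : S.around h (i + 1) = insert ((S.cycle h).vert (i + 2))
        (insert ((S.cycle h).vert (i + 1)) h.1) := Finset.insert_comm _ _ _
    rw [hcomm] at hτ hcτ ⊢
    rw [around] at hσ hcσ ⊢
    refine exists_isDevelopment (Finset.insert_nonempty _ _) ?_ ?_ hac hσ hτ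
    · intro ha
      rw [Finset.insert_eq_of_mem ha] at hcσ
      have := Finset.card_insert_le ((S.cycle h).vert (i + 1)) h.1
      omega
    · intro ha
      rw [Finset.insert_eq_of_mem ha] at hcτ
      have := Finset.card_insert_le ((S.cycle h).vert (i + 1)) h.1
      omega
  obtain ⟨g, hg, heq⟩ := exists_transport_eq hex
  rw [heq]
  exact hg.map_frame hne hc hσ hτ hac hθ

/-- In the frames of the successive simplices around a hinge, parallel transport is the rotation
by minus the sum of the dihedral angles passed. -/
theorem transportAlong_around (hn : 2 ≤ n) (h : S.Hinge) (k : ℕ) {Θ : ℝ}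
    (hΘ : Θ = ∑ i ∈ Finset.range k, S.dihedralAngle (S.around h i) h.1 ((S.cycle h).vert i)
      ((S.cycle h).vert (i + 1))) :
    S.transportAlong (S.around h) k (unitVec (S.firstNormal h 0)) =
        Real.cos Θ • unitVec (S.firstNormal h k) -
          Real.sin Θ • perpVec (S.firstNormal h k) (S.secondNormal h k) ∧
      S.transportAlong (S.around h) k (perpVec (S.firstNormal h 0) (S.secondNormal h 0)) =
        Real.sin Θ • unitVec (S.firstNormal h k) +
          Real.cos Θ • perpVec (S.firstNormal h k) (S.secondNormal h k) := by
  induction k generalizing Θ with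
  | zero => simp [hΘ, transportAlong]
  | succ k ih =>
    obtain ⟨h1, h2⟩ := ih rfl
    obtain ⟨h3, h4⟩ := S.transport_around hn h k rfl
    rw [Finset.sum_range_succ] at hΘ
    change Θ = _ + InnerProductGeometry.angle (S.firstNormal h k) (S.secondNormal h k) at hΘ
    simp only [transportAlong, LinearIsometryEquiv.trans_apply, h1, h2, map_sub, map_add, map_smul,
      h3, h4, hΘ, Real.cos_add, Real.sin_add]
    constructor <;> module

theorem scalarDensity_eq (hn : 2 ≤ n) (h : S.Hinge) :
    S.scalarDensity h = 2 * Real.sin (S.deficitAngle h) := by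
  have hne := h.nonempty hn
  have hσ := S.around_mem_facets h 0
  have hcσ := S.card_facet _ hσ
  have hsub := S.subset_around h 0
  have hc := h.2.1
  have ha : (S.cycle h).vert 0 ∈ S.around h 0 := by simp [around]
  have hb : (S.cycle h).vert 1 ∈ S.around h 0 := by simp [around]
  have hbh : (S.cycle h).vert 1 ∉ h.1 := by
    intro hb
    rw [around, zero_add, Finset.insert_eq_of_mem hb] at hcσ
    have := Finset.card_insert_le ((S.cycle h).vert 0) h.1
    omega
  have hah : (S.cycle h).vert 0 ∉ insert ((S.cycle h).vert 1) h.1 := by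
    intro ha
    rw [around, zero_add, Finset.insert_eq_of_mem ha] at hcσ
    have := Finset.card_insert_le ((S.cycle h).vert 1) h.1
    omega
  rw [Finset.mem_insert, not_or] at hah
  have hA := normalVec_ne_zero hσ hne hsub ha hah.2
  have hB := normalVec_ne_zero hσ hne hsub hb hbh
  have hs := sin_angle_normalVec_pos hσ hne hsub ha hb hbh hah.1
  obtain ⟨h1, h2⟩ := S.transportAlong_around hn h (S.cycle h).len rfl
  rw [firstNormal_len, secondNormal_len] at h1 h2
  have key := inner_map_sub_inner_map_of_rotation
    (T := ((S.holonomy h).toLinearEquiv :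
      EuclideanSpace ℝ (Fin n) →ₗ[ℝ] EuclideanSpace ℝ (Fin n))) hA hB hs h1 h2
  -- The two inner products of `key` are expanded back into basis sums, which match the two terms of
  -- the area form.
  rw [deficitAngle, Real.sin_two_pi_sub, mul_neg, ← neg_mul, ← key,
    ← sum_sum_inner_mul_inner_map (EuclideanSpace.basisFun (Fin n) ℝ),
    ← sum_sum_inner_mul_inner_map (EuclideanSpace.basisFun (Fin n) ℝ),
    ← Finset.sum_sub_distrib, Finset.sum_div, scalarDensity]
  refine Finset.sum_congr rfl fun i _ => ?_
  rw [← Finset.sum_sub_distrib, Finset.sum_div]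
  refine Finset.sum_congr rfl fun j _ => ?_
  simp only [sectionalDensity, normalArea]
  change _ = (_ * _ * ⟪S.holonomy h _, _⟫ - _ * _ * ⟪S.holonomy h _, _⟫) / _
  ring

theorem hingeVol_eq_zero {h : S.Hinge} {U : Set S.Point}
    (hU : ¬ (S.openSimplex h.1 ∩ U).Nonempty) : S.hingeVol h U = 0 := by
  rw [Set.inter_comm, Set.not_nonempty_iff_eq_empty] at hU
  simp [hingeVol, hingePart, hU]

/-- Stated for any region whose hinges contain `v`, so that it serves both the general tessellations
and the two explicit duals. -/
theorem averageScalar_eq (hn : 2 ≤ n) {U : Set S.Point} {v : V}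
    (hU : ∀ h : S.Hinge, (S.openSimplex h.1 ∩ U).Nonempty → v ∈ h.1) :
    S.averageScalar U = 2 / (S.vol U).toReal *
      ∑ h ∈ S.hingesAt v, S.hingeVol h U * Real.sin (S.deficitAngle h) := by
  have hint : S.integralScalar U =
      ∑ h ∈ S.hingesAt v, S.hingeVol h U * (2 * Real.sin (S.deficitAngle h)) := by
    have hterm : ∀ h : S.Hinge, ∫ _p in S.hingePart h U, S.scalarDensity h ∂μHE[n - 2] =
        S.hingeVol h U * (2 * Real.sin (S.deficitAngle h)) := fun h => by
      rw [setIntegral_const, smul_eq_mul, S.scalarDensity_eq hn, hingeVol]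
    rw [integralScalar, tsum_congr hterm]
    refine tsum_eq_sum fun h hh => ?_
    rw [S.hingeVol_eq_zero fun hne => hh (by simpa [hingesAt] using hU h hne), zero_mul]
  rw [averageScalar, hint, div_mul_eq_mul_div, Finset.mul_sum]
  congr 1
  exact Finset.sum_congr rfl fun h _ => by ring

/-- Termwise `|x - sin x| ≤ |x|³/6`. The factors `c = 2/|V_v|` and `c = 1/|V_v|` give the constants
`1/3` and `1/6`. -/
theorem abs_mul_sum_sin_sub_le {ι : Type*} (s : Finset ι) {a ε : ι → ℝ} {c : ℝ} (hc : 0 ≤ c)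
    (ha : ∀ i ∈ s, 0 ≤ a i) :
    |c * ∑ i ∈ s, a i * Real.sin (ε i) - c * ∑ i ∈ s, a i * ε i| ≤
      c / 6 * ∑ i ∈ s, a i * |ε i| ^ 3 := by
  rw [← mul_sub, ← Finset.sum_sub_distrib, abs_mul, abs_of_nonneg hc, div_mul_eq_mul_div,
    mul_div_assoc, Finset.sum_div]
  refine mul_le_mul_of_nonneg_left ((Finset.abs_sum_le_sum_abs _ _).trans
    (Finset.sum_le_sum fun i hi => ?_)) hc
  rw [← mul_sub, abs_mul, abs_of_nonneg (ha i hi), abs_sub_comm, mul_div_assoc]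
  exact mul_le_mul_of_nonneg_left (Real.abs_sub_sin_le _) (ha i hi)

theorem hingeVol_nonneg (h : S.Hinge) (U : Set S.Point) : 0 ≤ S.hingeVol h U :=
  measureReal_nonneg

end PiecewiseFlat

/-! ### Edges of three-dimensional manifolds -/

namespace PiecewiseFlat

variable {V : Type*} [DecidableEq V] {S : PiecewiseFlat 3 V}

theorem Hinge.exists_pair (h : S.Hinge) {v : V} (hv : v ∈ h.1) : ∃ w, w ≠ v ∧ h.1 = {v, w} := by
  have h2 : h.1.card = 2 := by have := h.2.1; omega
  obtain ⟨a, b, hab, he⟩ := Finset.card_eq_two.1 h2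
  rw [he, Finset.mem_insert, Finset.mem_singleton] at hv
  rcases hv with rfl | rfl
  · exact ⟨b, hab.symm, he⟩
  · exact ⟨a, hab, by rw [he, Finset.pair_comm]⟩

theorem add_eq_one_of_mem_openSimplex {v w : V} (hvw : w ≠ v) {p : S.Point}
    (hp : p ∈ S.openSimplex {v, w}) : p.1 v + p.1 w = 1 := by
  obtain ⟨σ, -, hσ, hsum⟩ := p.2.2
  have hmem : ({v, w} : Finset V) ⊆ σ := fun x hx => by
    by_contra hxσ
    exact (hp.1 x hx).ne' (hσ x hxσ)
  rwa [← Finset.sum_subset hmem fun x _ hx => hp.2 x hx, Finset.sum_pair hvw.symm] at hsum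

theorem place_eq_of_mem_openSimplex {v w : V} (hvw : w ≠ v) {p : S.Point}
    (hp : p ∈ S.openSimplex {v, w}) {σ : Finset V} (hσ : {v, w} ⊆ σ) :
    S.place σ p = AffineMap.lineMap (S.pos σ v) (S.pos σ w) (p.1 w) := by
  rw [place, ← Finset.sum_subset hσ fun x _ hx => by rw [hp.2 x hx, zero_smul],
    Finset.sum_pair hvw.symm, AffineMap.lineMap_apply_module,
    eq_sub_of_add_eq (add_eq_one_of_mem_openSimplex hvw hp)]

/-- The edge is parametrised by the barycentric coordinate at `w`; `r = 1/2` gives the half at `v`,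
`r = 1` the whole open edge. -/
theorem hingePart_eq {h : S.Hinge} {v w : V} (hvw : w ≠ v) (hh : h.1 = {v, w}) {U : Set S.Point}
    {r : ℝ} (hr : r ≤ 1) (hU : ∀ p ∈ S.openSimplex h.1, p ∈ U ↔ p.1 w < r) :
    S.hingePart h U =
      AffineMap.lineMap (S.pos (S.around h 0) v) (S.pos (S.around h 0) w) '' Set.Ioo (0 : ℝ) r := by
  have hsub := S.subset_around h 0
  ext x
  constructor
  · rintro ⟨p, ⟨hpU, hp⟩, rfl⟩
    have hlt := (hU p hp).1 hpU
    rw [hh] at hp hsub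
    exact ⟨p.1 w, ⟨hp.1 w (by simp), hlt⟩, (place_eq_of_mem_openSimplex hvw hp hsub).symm⟩
  · rintro ⟨t, ⟨ht0, htr⟩, rfl⟩
    let f : V → ℝ := fun x => if x = v then 1 - t else if x = w then t else 0
    have hfv : f v = 1 - t := by simp [f]
    have hfw : f w = t := by simp [f, hvw]
    have hf : ∀ x, x ∉ ({v, w} : Finset V) → f x = 0 := fun x hx => by
      simp only [Finset.mem_insert, Finset.mem_singleton, not_or] at hx
      simp [f, hx]
    have hsub' := hsub
    rw [hh] at hsub'
    let p : S.Point := ⟨f, fun x => by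
        by_cases hx : x ∈ ({v, w} : Finset V)
        · simp only [Finset.mem_insert, Finset.mem_singleton] at hx
          rcases hx with rfl | rfl
          · rw [hfv]; linarith
          · rw [hfw]; linarith
        · rw [hf x hx], S.around h 0, S.around_mem_facets h 0,
      fun x hx => hf x fun hx' => hx (hsub' hx'), by
        rw [← Finset.sum_subset hsub' fun x _ hx => hf x hx, Finset.sum_pair hvw.symm, hfv, hfw]
        ring⟩
    have hp : p ∈ S.openSimplex {v, w} := ⟨fun x hx => by
      simp only [Finset.mem_insert, Finset.mem_singleton] at hx
      rcases hx with rfl | rfl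
      · change 0 < f x
        rw [hfv]; linarith
      · change 0 < f x
        rw [hfw]; linarith, hf⟩
    refine ⟨p, ⟨(hU p (by rwa [hh])).2 (by change f w < r; rwa [hfw]), by rwa [hh]⟩, ?_⟩
    rw [place_eq_of_mem_openSimplex hvw hp hsub']
    change AffineMap.lineMap _ _ (f w) = _
    rw [hfw]

/-- The half edge is the image of the edge under the homothety at `v` of ratio `1/2`, which halves
one-dimensional measure. -/
theorem hingeVol_eq_half {h : S.Hinge} {v : V} (hv : v ∈ h.1) {U : Set S.Point}
    (hU : ∀ p ∈ S.openSimplex h.1, p ∈ U ↔ 1 / 2 < p.1 v) :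
    S.hingeVol h U = S.hingeVol h Set.univ / 2 := by
  obtain ⟨w, hvw, hh⟩ := h.exists_pair hv
  have h1 := hingePart_eq hvw hh (U := U) (r := 1 / 2) (by norm_num) fun p hp => by
    rw [hU p hp]
    rw [hh] at hp
    have := add_eq_one_of_mem_openSimplex hvw hp
    constructor <;> intro <;> linarith
  have h2 := hingePart_eq hvw hh (U := Set.univ) (r := 1) le_rfl fun p hp => by
    rw [hh] at hp
    have := add_eq_one_of_mem_openSimplex hvw hp
    have := hp.1 v (by simp)
    simp only [Set.mem_univ, true_iff]
    linarith
  set a := S.pos (S.around h 0) v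
  set b := S.pos (S.around h 0) w
  have h3 : AffineMap.lineMap a b '' Set.Ioo (0 : ℝ) (1 / 2) =
      AffineMap.homothety a (1 / 2 : ℝ) '' (AffineMap.lineMap a b '' Set.Ioo (0 : ℝ) 1) := by
    have h4 : Set.Ioo (0 : ℝ) (1 / 2) = (fun t => 1 / 2 * t) '' Set.Ioo (0 : ℝ) 1 := by
      rw [Set.image_mul_left_Ioo (by norm_num)]
      simp
    rw [h4, Set.image_image, Set.image_image]
    refine Set.image_congr fun t _ => ?_
    simp [AffineMap.homothety_apply, AffineMap.lineMap_apply, smul_smul]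
  rw [hingeVol, hingeVol, h1, h2, h3, measureReal_def, measureReal_def,
    euclideanHausdorffMeasure_homothety_image (𝕜 := ℝ) _ _ (by norm_num)]
  rw [ENNReal.smul_def, smul_eq_mul, ENNReal.toReal_mul]
  norm_num
  ring

/-! ### Dual cells along the edges. -/

theorem mem_barycentricDual_iff {h : S.Hinge} {v : V} (hv : v ∈ h.1) {p : S.Point}
    (hp : p ∈ S.openSimplex h.1) : p ∈ S.barycentricDual v ↔ 1 / 2 < p.1 v := by
  obtain ⟨w, hvw, hh⟩ := h.exists_pair hv
  rw [hh] at hp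
  have hsum := add_eq_one_of_mem_openSimplex hvw hp
  have hw := hp.1 w (by simp)
  constructor
  · intro hpU
    have := hpU w hvw
    linarith
  · intro hlt u hu
    by_cases huw : u = w
    · rw [huw]; linarith
    · rw [hp.2 u (by simp [hu, huw])]
      linarith

theorem mem_of_barycentricDual {h : S.Hinge} {v : V}
    (hne : (S.openSimplex h.1 ∩ S.barycentricDual v).Nonempty) : v ∈ h.1 := by
  obtain ⟨p, hp, hpU⟩ := hne
  by_contra hv
  obtain ⟨u, hu⟩ := h.nonempty (by norm_num)
  have h1 := hpU u fun he => hv (he ▸ hu)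
  have h2 := hp.1 u hu
  have h3 := hp.2 v hv
  linarith

/-- A triangle that contains its circumcenter has no obtuse angle. -/
theorem inner_nonneg_of_containsCircumcenters (hS : S.ContainsCircumcenters) {σ : Finset V}
    (hσ : σ ∈ S.facets) {u v w : V} (hu : u ∈ σ) (hv : v ∈ σ) (hw : w ∈ σ) :
    0 ≤ ⟪S.pos σ v - S.pos σ u, S.pos σ w - S.pos σ u⟫ := by
  obtain ⟨c, hc, r, hr⟩ := hS σ hσ {u, v, w} (by intro x; simp; grind) (by simp)
  have hru := hr u (by simp)
  have hrv := hr v (by simp)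
  have hrw := hr w (by simp)
  rw [Finset.coe_insert, Finset.coe_pair, Set.image_insert_eq, Set.image_pair,
    convexHull_insert (Set.insert_nonempty _ _), convexHull_pair, mem_convexJoin] at hc
  obtain ⟨_, rfl, d, ⟨s, t, hs, ht, hst, rfl⟩, ⟨s', t', hs', ht', hst', rfl⟩⟩ := hc
  set x := S.pos σ v - S.pos σ u with hx
  set y := S.pos σ w - S.pos σ u with hy
  set c := s' • S.pos σ u + t' • (s • S.pos σ v + t • S.pos σ w) with hc
  have hcu : c - S.pos σ u = (t' * s) • x + (t' * t) • y := by
    rw [hc, hx, hy, eq_sub_of_add_eq hst', eq_sub_of_add_eq hst]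
    module
  have hcv : c - S.pos σ v = (t' * s) • x + (t' * t) • y - x := by
    rw [← hcu, hx]; abel
  have hcw : c - S.pos σ w = (t' * s) • x + (t' * t) • y - y := by
    rw [← hcu, hy]; abel
  rw [← hru, dist_eq_norm, dist_eq_norm, ← sq_eq_sq₀ (norm_nonneg _) (norm_nonneg _), hcu]
    at hrv hrw
  rw [hcv] at hrv
  rw [hcw] at hrw
  have hα : 0 ≤ t' * s := mul_nonneg ht' hs
  have hβ : 0 ≤ t' * t := mul_nonneg ht' ht
  have hαβ : t' * s + t' * t ≤ 1 := by
    rw [← mul_add, hst, mul_one]; linarith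
  set α := t' * s
  set β := t' * t
  rw [norm_sub_sq_real, inner_add_left, real_inner_smul_left, real_inner_smul_left,
    real_inner_self_eq_norm_sq] at hrv hrw
  rw [real_inner_comm x y] at hrv
  have hx0 : 0 ≤ ‖x‖ ^ 2 := by positivity
  have hy0 : 0 ≤ ‖y‖ ^ 2 := by positivity
  by_contra! hneg
  have hx1 : 0 < ‖x‖ := norm_pos_iff.2 fun h0 => by simp [h0] at hneg
  have hy1 : 0 < ‖y‖ := norm_pos_iff.2 fun h0 => by simp [h0] at hneg
  -- Equidistance of the circumcenter `u + αx + βy` from the vertices. A negative inner product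
  -- gives `α ≥ 1/2`, then `β > 1/2`, against `α + β ≤ 1`.
  have e1 : (2 * α - 1) * ‖x‖ ^ 2 = -2 * (β * ⟪x, y⟫) := by linarith
  have e2 : (2 * β - 1) * ‖y‖ ^ 2 = -2 * (α * ⟪x, y⟫) := by linarith
  have f1 : 0 ≤ 2 * α - 1 := by
    refine nonneg_of_mul_nonneg_left (b := ‖x‖ ^ 2) ?_ (by positivity)
    rw [e1]
    have := mul_nonpos_of_nonneg_of_nonpos hβ hneg.le
    linarith
  have f2 : 0 < 2 * β - 1 := by
    refine pos_of_mul_pos_left (b := ‖y‖ ^ 2) ?_ hy0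
    rw [e2]
    have := mul_neg_of_pos_of_neg (show 0 < α by linarith) hneg
    linarith
  linarith

/-- On the half `t ≤ 1/2` near `v` the first term is nonnegative, and a non-obtuse angle at `u`
makes the second so. For `u = w` the second term vanishes, which gives the bisector of the edge. -/
theorem dist_sq_sub_dist_sq_lineMap {E : Type*} [NormedAddCommGroup E] [InnerProductSpace ℝ E]
    (u v w : E) (t : ℝ) :
    dist (AffineMap.lineMap v w t) u ^ 2 - dist (AffineMap.lineMap v w t) v ^ 2 =
      (1 - 2 * t) * ‖v - u‖ ^ 2 + 2 * t * ⟪v - u, w - u⟫ := by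
  have h1 : AffineMap.lineMap v w t - u = (1 - t) • (v - u) + t • (w - u) := by
    rw [AffineMap.lineMap_apply_module]; module
  have h2 : AffineMap.lineMap v w t - v = t • ((w - u) - (v - u)) := by
    rw [AffineMap.lineMap_apply_module]; module
  rw [dist_eq_norm, dist_eq_norm, h1, h2, norm_add_sq_real, norm_smul, norm_smul, norm_smul,
    mul_pow, mul_pow, mul_pow, norm_sub_sq_real (w - u), real_inner_smul_left, real_inner_smul_right,
    real_inner_comm (v - u) (w - u)]
  simp only [Real.norm_eq_abs, sq_abs]
  ring

theorem pos_ne_pos {σ : Finset V} (hσ : σ ∈ S.facets) {u v : V} (hu : u ∈ σ) (hv : v ∈ σ)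
    (huv : u ≠ v) : S.pos σ u ≠ S.pos σ v := fun h =>
  huv (congrArg Subtype.val ((S.affineIndependent σ hσ).injective
    (a₁ := ⟨u, hu⟩) (a₂ := ⟨v, hv⟩) h))

theorem mem_voronoiDual_iff (hS : S.ContainsCircumcenters) {h : S.Hinge} {v : V} (hv : v ∈ h.1)
    {p : S.Point} (hp : p ∈ S.openSimplex h.1) : p ∈ S.voronoiDual v ↔ 1 / 2 < p.1 v := by
  have hsub := S.subset_around h 0
  obtain ⟨w, hvw, hh⟩ := h.exists_pair hv
  rw [hh] at hp hsub
  have hsum := add_eq_one_of_mem_openSimplex hvw hp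
  have hw := hp.1 w (by simp)
  constructor
  · intro hpU
    have h1 := (hpU _ (S.around_mem_facets h 0) fun x hx => hp.2 x fun hx' => hx (hsub hx')).2 w
      (hsub (by simp)) hvw
    rw [place_eq_of_mem_openSimplex hvw hp hsub] at h1
    have h2 := pow_lt_pow_left₀ h1 dist_nonneg two_ne_zero
    have h3 := dist_sq_sub_dist_sq_lineMap (S.pos (S.around h 0) w) (S.pos (S.around h 0) v)
      (S.pos (S.around h 0) w) (p.1 w)
    rw [sub_self, inner_zero_right] at h3
    have h4 : 0 < 1 - 2 * p.1 w :=
      pos_of_mul_pos_left (b := ‖S.pos (S.around h 0) v - S.pos (S.around h 0) w‖ ^ 2)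
        (by linarith) (by positivity)
    linarith
  · intro hlt σ hσ hpσ
    have hvwσ : {v, w} ⊆ σ := fun x hx => by
      by_contra hxσ
      exact (hp.1 x hx).ne' (hpσ x hxσ)
    have hvσ : v ∈ σ := hvwσ (by simp)
    refine ⟨hvσ, fun u hu huv => ?_⟩
    rw [place_eq_of_mem_openSimplex hvw hp hvwσ]
    refine lt_of_pow_lt_pow_left₀ 2 dist_nonneg ?_
    rw [← sub_pos, dist_sq_sub_dist_sq_lineMap]
    -- The case `u = w` is included; the inner product is then zero.
    have h1 := inner_nonneg_of_containsCircumcenters hS hσ hu hvσ (hvwσ (by simp : w ∈ _))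
    have h2 : 0 < ‖S.pos σ v - S.pos σ u‖ :=
      norm_pos_iff.2 (sub_ne_zero.2 (pos_ne_pos hσ hvσ hu huv.symm))
    have h3 : 0 < 1 - 2 * p.1 w := by linarith
    positivity

/-- The end `a` of the edge with weight at least `1/2` is at least as close as any vertex of the
simplex off the edge, so no such vertex can be strictly nearest. -/
theorem mem_of_voronoiDual (hS : S.ContainsCircumcenters) {h : S.Hinge} {v : V}
    (hne : (S.openSimplex h.1 ∩ S.voronoiDual v).Nonempty) : v ∈ h.1 := by
  obtain ⟨p, hp, hpU⟩ := hne
  by_contra hv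
  have hsub := S.subset_around h 0
  have hσ := S.around_mem_facets h 0
  have hhalf : ∃ a ∈ h.1, 1 / 2 ≤ p.1 a := by
    obtain ⟨a, ha⟩ := h.nonempty (by norm_num)
    obtain ⟨b, hab, hh⟩ := h.exists_pair ha
    rw [hh] at hp ⊢
    have hsum := add_eq_one_of_mem_openSimplex hab hp
    by_cases hle : 1 / 2 ≤ p.1 a
    · exact ⟨a, by simp, hle⟩
    · exact ⟨b, by simp, by linarith⟩
  obtain ⟨a, ha, hle⟩ := hhalf
  obtain ⟨b, hab, hh⟩ := h.exists_pair ha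
  obtain ⟨hvσ, hlt⟩ := hpU _ hσ fun x hx => hp.2 x fun hx' => hx (hsub hx')
  have h1 := hlt a (hsub ha) fun he => hv (he ▸ ha)
  rw [hh] at hp hsub
  have hsum := add_eq_one_of_mem_openSimplex hab hp
  have hb := hp.1 b (by simp)
  rw [place_eq_of_mem_openSimplex hab hp hsub] at h1
  have h2 := pow_lt_pow_left₀ h1 dist_nonneg two_ne_zero
  have h3 := dist_sq_sub_dist_sq_lineMap (S.pos (S.around h 0) v) (S.pos (S.around h 0) a)
    (S.pos (S.around h 0) b) (p.1 b)
  have h4 := inner_nonneg_of_containsCircumcenters hS hσ hvσ (hsub (by simp : a ∈ _))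
    (hsub (by simp : b ∈ _))
  have h5 : 0 ≤ (1 - 2 * p.1 b) * ‖S.pos (S.around h 0) a - S.pos (S.around h 0) v‖ ^ 2 :=
    mul_nonneg (by linarith) (by positivity)
  have h6 := mul_nonneg hb.le h4
  linarith

end PiecewiseFlat

end

/-! ### The averages over dual cells. -/

theorem mainTheorem2 :
    -- arbitrary dual tessellations, in every dimension `n ≥ 2`
    (∀ (n : ℕ), 2 ≤ n → ∀ (V : Type*) [DecidableEq V] (S : PiecewiseFlat n V)
      (D : V → Set S.Point), S.IsDualTessellation D → ∀ v : V,
        S.averageScalar (D v) = 2 / (S.vol (D v)).toReal *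
            ∑ h ∈ S.hingesAt v, S.hingeVol h (D v) * Real.sin (S.deficitAngle h) ∧
        |S.averageScalar (D v) - 2 / (S.vol (D v)).toReal *
            ∑ h ∈ S.hingesAt v, S.hingeVol h (D v) * S.deficitAngle h| ≤
          1 / (3 * (S.vol (D v)).toReal) *
            ∑ h ∈ S.hingesAt v, S.hingeVol h (D v) * |S.deficitAngle h| ^ 3) ∧
    -- barycentric and Voronoi duals, in dimension three
    (∀ (V : Type*) [DecidableEq V] (S : PiecewiseFlat 3 V) (D : V → Set S.Point),
      (D = S.barycentricDual ∨ (S.ContainsCircumcenters ∧ D = S.voronoiDual)) → ∀ v : V,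
        S.averageScalar (D v) = 1 / (S.vol (D v)).toReal *
            ∑ h ∈ S.hingesAt v, S.hingeVol h Set.univ * Real.sin (S.deficitAngle h) ∧
        |S.averageScalar (D v) - 1 / (S.vol (D v)).toReal *
            ∑ h ∈ S.hingesAt v, S.hingeVol h Set.univ * S.deficitAngle h| ≤
          1 / (6 * (S.vol (D v)).toReal) *
            ∑ h ∈ S.hingesAt v, S.hingeVol h Set.univ * |S.deficitAngle h| ^ 3) := by
  constructor
  · intro n hn V _ S D hD v
    have havg := S.averageScalar_eq hn (hD.hinge_mem v)
    refine ⟨havg, ?_⟩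
    rw [havg]
    refine (PiecewiseFlat.abs_mul_sum_sin_sub_le _ (by positivity) fun h _ =>
      S.hingeVol_nonneg h _).trans_eq ?_
    ring
  · intro V _ S D hD v
    have hmem : ∀ h : S.Hinge, (S.openSimplex h.1 ∩ D v).Nonempty → v ∈ h.1 := by
      rcases hD with rfl | ⟨hS, rfl⟩
      · exact fun h => PiecewiseFlat.mem_of_barycentricDual
      · exact fun h => PiecewiseFlat.mem_of_voronoiDual hS
    have hhalf : ∀ h ∈ S.hingesAt v, S.hingeVol h (D v) = S.hingeVol h Set.univ / 2 := by
      intro h hh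
      have hv : v ∈ h.1 := by simpa [PiecewiseFlat.hingesAt] using hh
      rcases hD with rfl | ⟨hS, rfl⟩
      · exact PiecewiseFlat.hingeVol_eq_half hv fun p hp =>
          PiecewiseFlat.mem_barycentricDual_iff hv hp
      · exact PiecewiseFlat.hingeVol_eq_half hv fun p hp =>
          PiecewiseFlat.mem_voronoiDual_iff hS hv hp
    have havg : S.averageScalar (D v) = 1 / (S.vol (D v)).toReal *
        ∑ h ∈ S.hingesAt v, S.hingeVol h Set.univ * Real.sin (S.deficitAngle h) := by
      rw [S.averageScalar_eq (by norm_num) hmem, Finset.mul_sum, Finset.mul_sum]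
      refine Finset.sum_congr rfl fun h hh => ?_
      rw [hhalf h hh]
      ring
    refine ⟨havg, ?_⟩
    rw [havg]
    refine (PiecewiseFlat.abs_mul_sum_sin_sub_le _ (by positivity) fun h _ =>
      S.hingeVol_nonneg h _).trans_eq ?_
    ring
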